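/- Let $R$ be a commutative ring, $A$ an associative unital $R$-algebra and $(C,\Delta,\varepsilon)$ a coassociative counital $R$-coalgebra; $\otimes=\otimes_R$. A \emph{right-right entwining structure} $(A,C,\psi)$ is given by an $R$-linear map $\psi:C\otimes A\to A\otimes C$, $c\otimes a\mapsto\sum a_\psi\otimes c^\psi$, with $$\sum (ab)_\psi\otimes c^\psi=\sum a_\psi b_\Psi\otimes c^{\psi\Psi},\quad \sum 1_\psi\otimes c^\psi=1\otimes c,\quad \sum a_\psi\otimes\Delta(c^\psi)=\sum a_{\psi\Psi}\otimes c_1^{\Psi}\otimes c_2^{\psi},\quad \sum a_\psi\varepsilon(c^\psi)=\varepsilon(c)a .$$ An \emph{entwined module} is a right $A$-module $M$ that is also a (coassociative, counital) right $C$-comodule by $\varrho_M:M\to M\otimes C$, $m\mapsto\sum m_{<0>}\otimes m_{<1>}$, with $\varrho_M(ma)=\sum m_{<0>}a_\psi\otimes m_{<1>}^\psi$; $\mathcal M_A^C(\psi)$ is the category of entwined modules and $A$-linear $C$-colinear maps. Let $\#:=\#^{op}_\psi(C,A)$ be the ring $\mathrm{Hom}_R(C,A)$ with product $(f\cdot g)(c)=\sum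 f(c_2)_\psi\, g(c_1^\psi)$ and unit $c\mapsto\varepsilon(c)1_A$, and $\mathcal M_\#$ its category of right modules; a right $\#$-module is an $A$-module through the ring map $A\to\#$, $a\mapsto\varepsilon(-)a$. Every entwined module is a right $\#$-module by $mf=\sum m_{<0>}f(m_{<1>})$; this gives a functor $\Phi:\mathcal M_A^C(\psi)\to\mathcal M_\#$ which is the identity on underlying groups and on maps. The module $A\otimes C$ is entwined by $(\tilde a\otimes c)a=\sum\tilde a a_\psi\otimes c^\psi$ and $\mathrm{id}_A\otimes\Delta$, hence is a right $\#$-module. For a right $\#$-module $M$ let $\mathrm{Rat}^C(M)$ be the set of all $m\in M$ for which there is $\sum m_i\otimes c_i\in M\otimes C$ with $mf=\sum m_if(c_i)$ for all $f\in\#$; $\mathrm{Rat}^C(\mathcal M_\#)$ is the full subcategory of $\mathcal M_\#$ of the modules with $\mathrm{Rat}^C(M)=M$. For a right $\#$-module $K$, $\sigma[K_\#]$ is the full subcategory of $\mathcal M_\#$ of the modules isomorphic to a submodule of a quotient of a direct sum of copies of $K$. An $R$-module $W$ is \emph{locally projective} if for every surjective $\pi:L\to N$, every $g:W\to N$ and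 every finitely generated submodule $F\subseteq W$ there is $g':W\to L$ with $\pi g'|_F=g|_F$. \textbf{Theorem.} Let $(A,C,\psi)$ be a right-right entwining structure over $R$. (1) If $C$ is flat over $R$, then $\mathcal M_A^C(\psi)$ is a Grothendieck category with enough injective objects. (2) If $C$ is locally projective over $R$, then for every right $A$-module $M$ the map $M\otimes C\to\mathrm{Hom}_R(\#,M)$, $m\otimes c\mapsto[f\mapsto mf(c)]$, is injective (the $\alpha$-condition, so that the elements $\sum m_i\otimes c_i$ above are unique), and $\Phi$ induces isomorphisms of categories $$\mathcal M_A^C(\psi)\simeq \mathrm{Rat}^C(\mathcal M_{\#^{op}_\psi(C,A)})=\sigma[(A\otimes C)_{\#^{op}_\psi(C,A)}].$$ (3) If $C$ is finitely generated and projective over $R$, then $\Phi:\mathcal M_A^C(\psi)\to\mathcal M_{\#^{op}_\psi(C,A)}$ is an isomorphism of categories. -/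

import Mathlib

open scoped TensorProduct
open CategoryTheory MulOpposite

universe u v w v' w'


noncomputable section

/-- Local projectivity: every linear map `g : W → N` can be lifted along every surjection
`p : L → N` after restriction to any finitely generated submodule `F` of `W`. -/
def IsLocallyProjective (R W : Type u) [CommRing R] [AddCommGroup W] [Module R W] : Prop :=
  ∀ (F : Submodule R W), F.FG →
    ∀ (L N : Type u) [AddCommGroup L] [Module R L] [AddCommGroup N] [Module R N]
      (p : L →ₗ[R] N) (g : W →ₗ[R] N), Function.Surjective p →
      ∃ g' : W →ₗ[R] L, ∀ x ∈ F, p (g' x) = g x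

/-- A functor is an isomorphism of categories: bijective on objects and on morphisms. -/
structure IsIsomorphismOfCategories {C : Type v} {D : Type w} [Category.{v'} C] [Category.{w'} D]
    (F : C ⥤ D) : Prop where
  full : F.Full
  faithful : F.Faithful
  bijective_obj : Function.Bijective F.obj

/-- The category `σ[K]` of `K`-subgenerated `S`-modules, as a property of `S`-modules: `N` is
isomorphic to a submodule of a module `P` that is a quotient of a direct sum of copies of `K`. -/
def IsSubgenerated {S : Type u} [Ring S] (K : ModuleCat.{u} S) :
    ObjectProperty (ModuleCat.{u} S) := fun N =>
  ∃ (I : Type u) (P : ModuleCat.{u} S) (q : (I →₀ K) →ₗ[S] P) (j : N →ₗ[S] P),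
    Function.Surjective q ∧ Function.Injective j

section Unbundled

variable {R A C : Type u} [CommRing R] [Ring A] [Algebra R A] [AddCommGroup C] [Module R C]

/-- The right action `m ↦ m a` of `A` on a right `A`-module (a left `Aᵐᵒᵖ`-module) `M`,
as the bilinear map `(m, a) ↦ m a`. -/
def rightMul (R A M : Type u) [CommRing R] [Ring A] [Algebra R A] [AddCommGroup M] [Module R M]
    [Module Aᵐᵒᵖ M] [IsScalarTower R Aᵐᵒᵖ M] : M →ₗ[R] A →ₗ[R] M :=
  LinearMap.mk₂ R (fun m a => op a • m)
    (fun m n a => smul_add _ _ _)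
    (fun r m a => smul_comm _ _ _)
    (fun m a b => by rw [MulOpposite.op_add, add_smul])
    (fun r m a => by rw [MulOpposite.op_smul, smul_assoc])

@[simp] theorem rightMul_apply (M : Type u) [AddCommGroup M] [Module R M]
    [Module Aᵐᵒᵖ M] [IsScalarTower R Aᵐᵒᵖ M] (m : M) (a : A) :
    rightMul R A M m a = op a • m := rfl

/-- For `f : C → A` the map `M ⊗ C → M`, `m ⊗ c ↦ m f(c)`. -/
def evalAt (M : Type u) [AddCommGroup M] [Module R M]
    [Module Aᵐᵒᵖ M] [IsScalarTower R Aᵐᵒᵖ M] (f : C →ₗ[R] A) : M ⊗[R] C →ₗ[R] M :=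
  TensorProduct.lift ((rightMul R A M).compl₂ f)

@[simp] theorem evalAt_tmul (M : Type u) [AddCommGroup M] [Module R M]
    [Module Aᵐᵒᵖ M] [IsScalarTower R Aᵐᵒᵖ M] (f : C →ₗ[R] A) (m : M) (c : C) :
    evalAt M f (m ⊗ₜ c) = op (f c) • m := rfl

end Unbundled

/-- A right-right entwining structure `(A, C, ψ)` over `R`. Below, `ψ (c ⊗ a) = ∑ a_ψ ⊗ c^ψ`. -/
structure EntwiningStructure (R A C : Type u) [CommRing R] [Ring A] [Algebra R A]
    [AddCommGroup C] [Module R C] [Coalgebra R C] where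
  /-- the entwining map `ψ : C ⊗ A → A ⊗ C` -/
  psi : C ⊗[R] A →ₗ[R] A ⊗[R] C
  /-- `∑ (a b)_ψ ⊗ c^ψ = ∑ a_ψ b_Ψ ⊗ c^{ψΨ}` -/
  psi_mul : ∀ (c : C) (a b : A),
    psi (c ⊗ₜ (a * b)) =
      (LinearMap.mul' R A).rTensor C ((TensorProduct.assoc R A A C).symm
        (psi.lTensor A (TensorProduct.assoc R A C A (psi (c ⊗ₜ a) ⊗ₜ b))))
  /-- `∑ 1_ψ ⊗ c^ψ = 1 ⊗ c` -/
  psi_one : ∀ c : C, psi (c ⊗ₜ 1) = 1 ⊗ₜ c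
  /-- `∑ a_ψ ⊗ Δ(c^ψ) = ∑ a_{ψΨ} ⊗ c₁^Ψ ⊗ c₂^ψ` -/
  psi_comul : ∀ (c : C) (a : A),
    (Coalgebra.comul (R := R) (A := C)).lTensor A (psi (c ⊗ₜ a)) =
      TensorProduct.assoc R A C C (psi.rTensor C ((TensorProduct.assoc R C A C).symm
        (psi.lTensor C (TensorProduct.assoc R C C A (Coalgebra.comul (R := R) c ⊗ₜ a)))))
  /-- `∑ a_ψ ε(c^ψ) = ε(c) a` -/
  psi_counit : ∀ (c : C) (a : A),
    TensorProduct.rid R A ((Coalgebra.counit (R := R) (A := C)).lTensor A (psi (c ⊗ₜ a))) =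
      Coalgebra.counit (R := R) c • a

namespace EntwiningStructure

variable {R A C : Type u} [CommRing R] [Ring A] [Algebra R A]
  [AddCommGroup C] [Module R C] [Coalgebra R C] (E : EntwiningStructure R A C)

section TwistedAction

variable (M : Type u) [AddCommGroup M] [Module R M] [Module Aᵐᵒᵖ M] [IsScalarTower R Aᵐᵒᵖ M]

/-- For a right `A`-module `M`, the map `(M ⊗ C) ⊗ A → M ⊗ C`,
`(m ⊗ c) ⊗ a ↦ ∑ m a_ψ ⊗ c^ψ`. -/
def twist : (M ⊗[R] C) ⊗[R] A →ₗ[R] M ⊗[R] C :=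
  (TensorProduct.lift (rightMul R A M)).rTensor C ∘ₗ
    (TensorProduct.assoc R M A C).symm.toLinearMap ∘ₗ
      E.psi.lTensor M ∘ₗ (TensorProduct.assoc R M C A).toLinearMap

end TwistedAction

/-- A (right-right) entwined module: a right `A`-module and a (coassociative, counital) right
`C`-comodule `M` over the same `R`-module structure, with
`ϱ(m a) = ∑ m₀ a_ψ ⊗ m₁^ψ`. -/
structure EntwinedModule where
  carrier : Type u
  [addCommGroup : AddCommGroup carrier]
  [module : Module R carrier]
  [moduleA : Module Aᵐᵒᵖ carrier]
  [isScalarTower : IsScalarTower R Aᵐᵒᵖ carrier]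
  /-- the coaction `ϱ : M → M ⊗ C` -/
  coact : carrier →ₗ[R] carrier ⊗[R] C
  coassoc : ∀ m : carrier,
    TensorProduct.assoc R carrier C C (coact.rTensor C (coact m)) =
      (Coalgebra.comul (R := R) (A := C)).lTensor carrier (coact m)
  counit : ∀ m : carrier,
    TensorProduct.rid R carrier
      ((Coalgebra.counit (R := R) (A := C)).lTensor carrier (coact m)) = m
  compat : ∀ (m : carrier) (a : A), coact (op a • m) = E.twist carrier (coact m ⊗ₜ a)

namespace EntwinedModule

attribute [instance] addCommGroup module moduleA isScalarTower

variable {E}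

/-- Morphisms of entwined modules: the `A`-linear and `C`-colinear maps. -/
@[ext] structure Hom (M N : E.EntwinedModule) where
  toLinearMap : M.carrier →ₗ[Aᵐᵒᵖ] N.carrier
  colinear : ∀ m : M.carrier,
    N.coact (toLinearMap m) = (toLinearMap.restrictScalars R).rTensor C (M.coact m)

/-- The category of entwined modules. -/
instance : Category.{u} E.EntwinedModule where
  Hom M N := Hom M N
  id M := ⟨LinearMap.id, fun m => by
    change M.coact m = LinearMap.rTensor C (LinearMap.id : M.carrier →ₗ[R] M.carrier) (M.coact m)
    simp⟩
  comp {M N P} f g := ⟨g.toLinearMap ∘ₗ f.toLinearMap, fun m => by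
    change P.coact (g.toLinearMap (f.toLinearMap m)) =
      LinearMap.rTensor C (g.toLinearMap.restrictScalars R ∘ₗ f.toLinearMap.restrictScalars R)
        (M.coact m)
    rw [g.colinear, f.colinear, LinearMap.rTensor_comp_apply]⟩
  id_comp f := Hom.ext (LinearMap.comp_id _)
  comp_id f := Hom.ext (LinearMap.id_comp _)
  assoc f g h := rfl

end EntwinedModule

section TwistedAction

variable (M : Type u) [AddCommGroup M] [Module R M] [Module Aᵐᵒᵖ M] [IsScalarTower R Aᵐᵒᵖ M]

theorem twist_tmul (m : M) (c : C) (a : A) :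
    E.twist M ((m ⊗ₜ c) ⊗ₜ a) = (rightMul R A M m).rTensor C (E.psi (c ⊗ₜ a)) := by
  simp only [twist, LinearMap.comp_apply, LinearEquiv.coe_coe, TensorProduct.assoc_tmul,
    LinearMap.lTensor_tmul]
  induction E.psi (c ⊗ₜ a) with
  | zero => simp
  | tmul b d => simp
  | add y z hy hz => simp only [TensorProduct.tmul_add, map_add, hy, hz]

theorem twist_one (x : M ⊗[R] C) : E.twist M (x ⊗ₜ 1) = x := by
  induction x with
  | zero => simp
  | tmul m c => rw [twist_tmul, E.psi_one]; simp
  | add y z hy hz => simp only [TensorProduct.add_tmul, map_add, hy, hz]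

theorem twist_mul (x : M ⊗[R] C) (a b : A) :
    E.twist M (x ⊗ₜ (a * b)) = E.twist M (E.twist M (x ⊗ₜ a) ⊗ₜ b) := by
  induction x with
  | zero => simp
  | add y z hy hz => simp only [TensorProduct.add_tmul, map_add, hy, hz]
  | tmul m c =>
    rw [twist_tmul, twist_tmul, E.psi_mul]
    induction E.psi (c ⊗ₜ a) with
    | zero => simp
    | add y z hy hz => simp only [TensorProduct.add_tmul, map_add, hy, hz]
    | tmul a' c' =>
      simp only [TensorProduct.assoc_tmul, LinearMap.lTensor_tmul, LinearMap.rTensor_tmul,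
        twist_tmul]
      induction E.psi (c' ⊗ₜ b) with
      | zero => simp
      | add y z hy hz => simp only [TensorProduct.tmul_add, map_add, hy, hz]
      | tmul a'' c'' => simp [mul_smul]

/-- The right `A`-action `(m ⊗ c) a = ∑ m a_ψ ⊗ c^ψ` on `M ⊗ C`. -/
@[reducible] def twistedModule : Module Aᵐᵒᵖ (M ⊗[R] C) where
  smul a x := E.twist M (x ⊗ₜ unop a)
  one_smul x := E.twist_one M x
  mul_smul a b x := E.twist_mul M x (unop b) (unop a)
  smul_zero a := by
    change E.twist M (0 ⊗ₜ unop a) = 0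
    rw [TensorProduct.zero_tmul, map_zero]
  smul_add a x y := by
    change E.twist M ((x + y) ⊗ₜ unop a) = E.twist M (x ⊗ₜ unop a) + E.twist M (y ⊗ₜ unop a)
    rw [← map_add, ← TensorProduct.add_tmul]
  add_smul a b x := by
    change E.twist M (x ⊗ₜ (unop a + unop b)) =
      E.twist M (x ⊗ₜ unop a) + E.twist M (x ⊗ₜ unop b)
    rw [← map_add, ← TensorProduct.tmul_add]
  zero_smul x := by
    change E.twist M (x ⊗ₜ 0) = 0
    rw [TensorProduct.tmul_zero, map_zero]

/-- For a right `A`-module `M`, the `R`-module `M ⊗ C` with the right `A`-action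
`(m ⊗ c) a = ∑ m a_ψ ⊗ c^ψ`. This is a type synonym: the plain tensor product already carries
a different action of `Aᵐᵒᵖ`. -/
def Cofree (_E : EntwiningStructure R A C) (M : Type u) [AddCommGroup M] [Module R M] : Type u :=
  M ⊗[R] C

instance : AddCommGroup (E.Cofree M) := inferInstanceAs (AddCommGroup (M ⊗[R] C))

instance : Module R (E.Cofree M) := inferInstanceAs (Module R (M ⊗[R] C))

/-- The identity `M ⊗ C → Cofree M`. -/
def toCofree : M ⊗[R] C ≃ₗ[R] E.Cofree M := LinearEquiv.refl R (M ⊗[R] C)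

instance : Module Aᵐᵒᵖ (E.Cofree M) := E.twistedModule M

theorem op_smul_toCofree (a : A) (x : M ⊗[R] C) :
    op a • E.toCofree M x = E.toCofree M (E.twist M (x ⊗ₜ a)) := rfl

instance : IsScalarTower R Aᵐᵒᵖ (E.Cofree M) where
  smul_assoc r a x := by
    obtain ⟨x, rfl⟩ := (E.toCofree M).surjective x
    obtain ⟨a, rfl⟩ := MulOpposite.op_surjective a
    rw [← MulOpposite.op_smul, op_smul_toCofree, op_smul_toCofree, TensorProduct.tmul_smul,
      map_smul, map_smul]

/-- The coaction `m ⊗ c ↦ ∑ (m ⊗ c₁) ⊗ c₂` on `M ⊗ C`. -/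
def cofreeCoact : E.Cofree M →ₗ[R] E.Cofree M ⊗[R] C :=
  (E.toCofree M).toLinearMap.rTensor C ∘ₗ (TensorProduct.assoc R M C C).symm.toLinearMap ∘ₗ
    (Coalgebra.comul (R := R) (A := C)).lTensor M ∘ₗ (E.toCofree M).symm.toLinearMap

theorem cofreeCoact_toCofree (x : M ⊗[R] C) :
    E.cofreeCoact M (E.toCofree M x) =
      (E.toCofree M).toLinearMap.rTensor C ((TensorProduct.assoc R M C C).symm
        ((Coalgebra.comul (R := R) (A := C)).lTensor M x)) := by
  simp [cofreeCoact]

theorem cofreeCoact_coassoc (x : E.Cofree M) :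
    TensorProduct.assoc R (E.Cofree M) C C
      ((E.cofreeCoact M).rTensor C (E.cofreeCoact M x)) =
      (Coalgebra.comul (R := R) (A := C)).lTensor (E.Cofree M) (E.cofreeCoact M x) := by
  obtain ⟨x, rfl⟩ := (E.toCofree M).surjective x
  induction x with
  | zero => simp
  | add y z hy hz => simp only [map_add, hy, hz]
  | tmul m c =>
    let j : C →ₗ[R] E.Cofree M := (E.toCofree M).toLinearMap ∘ₗ TensorProduct.mk R M C m
    have key (c : C) : E.cofreeCoact M (j c) = j.rTensor C (Coalgebra.comul (R := R) c) := by
      change E.cofreeCoact M (E.toCofree M (m ⊗ₜ c)) = _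
      rw [cofreeCoact_toCofree, LinearMap.lTensor_tmul]
      induction Coalgebra.comul (R := R) c with
      | zero => simp
      | add y z hy hz => simp only [TensorProduct.tmul_add, map_add, hy, hz]
      | tmul a b => simp [j]
    have key2 : E.cofreeCoact M ∘ₗ j = j.rTensor C ∘ₗ Coalgebra.comul (R := R) :=
      LinearMap.ext key
    change TensorProduct.assoc R (E.Cofree M) C C
      ((E.cofreeCoact M).rTensor C (E.cofreeCoact M (j c))) =
      (Coalgebra.comul (R := R) (A := C)).lTensor (E.Cofree M) (E.cofreeCoact M (j c))
    rw [key, ← LinearMap.rTensor_comp_apply, key2, LinearMap.rTensor_comp_apply]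
    have h := Coalgebra.coassoc_apply (R := R) c
    have hL (z : (C ⊗[R] C) ⊗[R] C) :
        TensorProduct.assoc R (E.Cofree M) C C ((j.rTensor C).rTensor C z) =
          j.rTensor (C ⊗[R] C) (TensorProduct.assoc R C C C z) := by
      induction z with
      | zero => simp
      | add y z hy hz => simp only [map_add, hy, hz]
      | tmul w b =>
        induction w with
        | zero => simp
        | add y z hy hz => simp only [TensorProduct.add_tmul, map_add, hy, hz]
        | tmul a b => simp
    rw [hL, h]
    exact LinearMap.congr_fun
      ((LinearMap.rTensor_comp_lTensor _ _ _).trans (LinearMap.lTensor_comp_rTensor _ _ _).symm) _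

theorem cofreeCoact_counit (x : E.Cofree M) :
    TensorProduct.rid R (E.Cofree M)
      ((Coalgebra.counit (R := R) (A := C)).lTensor (E.Cofree M) (E.cofreeCoact M x)) = x := by
  obtain ⟨x, rfl⟩ := (E.toCofree M).surjective x
  induction x with
  | zero => simp
  | add y z hy hz => simp only [map_add, hy, hz]
  | tmul m c =>
    rw [cofreeCoact_toCofree, LinearMap.lTensor_tmul]
    have h := congrArg (TensorProduct.rid R C) (Coalgebra.lTensor_counit_comul (R := R) c)
    rw [TensorProduct.rid_tmul, one_smul] at h
    have h2 (z : C ⊗[R] C) : TensorProduct.rid R (E.Cofree M)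
        ((Coalgebra.counit (R := R) (A := C)).lTensor (E.Cofree M)
          ((E.toCofree M).toLinearMap.rTensor C ((TensorProduct.assoc R M C C).symm (m ⊗ₜ z)))) =
        E.toCofree M (m ⊗ₜ TensorProduct.rid R C
          ((Coalgebra.counit (R := R) (A := C)).lTensor C z)) := by
      induction z with
      | zero => simp
      | add y z hy hz => simp only [TensorProduct.tmul_add, map_add, hy, hz]
      | tmul a b => simp
    rw [h2, h]

theorem cofreeCoact_compat (x : E.Cofree M) (a : A) :
    E.cofreeCoact M (op a • x) = E.twist (E.Cofree M) (E.cofreeCoact M x ⊗ₜ a) := by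
  obtain ⟨x, rfl⟩ := (E.toCofree M).surjective x
  rw [op_smul_toCofree, cofreeCoact_toCofree, cofreeCoact_toCofree]
  induction x with
  | zero => simp
  | add y z hy hz => simp only [TensorProduct.add_tmul, map_add, hy, hz]
  | tmul m c =>
    rw [twist_tmul, ← LinearMap.comp_apply (LinearMap.lTensor _ _), LinearMap.lTensor_comp_rTensor,
      ← LinearMap.rTensor_comp_lTensor, LinearMap.comp_apply, E.psi_comul,
      LinearMap.lTensor_tmul]
    induction Coalgebra.comul (R := R) c with
    | zero => simp
    | add y z hy hz => simp only [TensorProduct.tmul_add, TensorProduct.add_tmul, map_add, hy, hz]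
    | tmul c₁ c₂ =>
      simp only [TensorProduct.assoc_tmul, LinearMap.lTensor_tmul, TensorProduct.assoc_symm_tmul,
        LinearMap.rTensor_tmul, twist_tmul, LinearEquiv.coe_coe]
      induction E.psi (c₂ ⊗ₜ a) with
      | zero => simp
      | add y z hy hz => simp only [TensorProduct.tmul_add, map_add, hy, hz]
      | tmul a' c' =>
        simp only [TensorProduct.assoc_symm_tmul, LinearMap.rTensor_tmul, rightMul_apply,
          op_smul_toCofree, twist_tmul]
        induction E.psi (c₁ ⊗ₜ a') with
        | zero => simp
        | add y z hy hz => simp only [TensorProduct.add_tmul, map_add, hy, hz]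
        | tmul a'' c'' => simp

/-- `M ⊗ C` as an entwined module. -/
def cofree : E.EntwinedModule where
  carrier := E.Cofree M
  coact := E.cofreeCoact M
  coassoc := E.cofreeCoact_coassoc M
  counit := E.cofreeCoact_counit M
  compat := E.cofreeCoact_compat M

end TwistedAction

section Sharp

/-- `∑ f(c₂)_ψ ⊗ c₁^ψ`, as a function of `c`. -/
def sharpTwist (f : C →ₗ[R] A) : C →ₗ[R] A ⊗[R] C :=
  E.psi ∘ₗ f.lTensor C ∘ₗ Coalgebra.comul (R := R)

/-- The product `(f · g)(c) = ∑ f(c₂)_ψ g(c₁^ψ)`. -/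
def sharpMul (f g : C →ₗ[R] A) : C →ₗ[R] A := evalAt A g ∘ₗ E.sharpTwist f

/-- The map `c ↦ ε(c) a`. -/
def sharpConst (a : A) : C →ₗ[R] A := (Coalgebra.counit (R := R) (A := C)).smulRight a

theorem evalAt_sharpConst (M : Type u) [AddCommGroup M] [Module R M] [Module Aᵐᵒᵖ M]
    [IsScalarTower R Aᵐᵒᵖ M] (a : A) (x : M ⊗[R] C) :
    evalAt M (sharpConst a) x = op a • TensorProduct.rid R M
      ((Coalgebra.counit (R := R) (A := C)).lTensor M x) := by
  induction x with
  | zero => simp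
  | add y z hy hz => simp only [map_add, hy, hz, smul_add]
  | tmul m c =>
    rw [evalAt_tmul, LinearMap.lTensor_tmul, TensorProduct.rid_tmul, sharpConst,
      LinearMap.smulRight_apply, MulOpposite.op_smul, smul_assoc, smul_comm]

theorem counit_sharpTwist (f : C →ₗ[R] A) (c : C) :
    TensorProduct.rid R A ((Coalgebra.counit (R := R) (A := C)).lTensor A
      (E.sharpTwist f c)) = f c := by
  have h := congrArg (TensorProduct.lid R C) (Coalgebra.rTensor_counit_comul (R := R) c)
  rw [TensorProduct.lid_tmul, one_smul] at h
  have h2 (z : C ⊗[R] C) : TensorProduct.rid R A ((Coalgebra.counit (R := R) (A := C)).lTensor A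
      (E.psi (f.lTensor C z))) =
      f (TensorProduct.lid R C ((Coalgebra.counit (R := R) (A := C)).rTensor C z)) := by
    induction z with
    | zero => simp
    | add y z hy hz => simp only [map_add, hy, hz]
    | tmul a b => rw [LinearMap.lTensor_tmul, E.psi_counit]; simp
  change TensorProduct.rid R A ((Coalgebra.counit (R := R) (A := C)).lTensor A
      (E.psi (f.lTensor C (Coalgebra.comul (R := R) c)))) = f c
  rw [h2, h]

variable {E} in
/-- The right action `m f = ∑ m₀ f(m₁)` of a linear map `f : C → A` on an entwined module. -/
def EntwinedModule.act (M : E.EntwinedModule) (f : C →ₗ[R] A) : M.carrier →ₗ[R] M.carrier :=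
  evalAt M.carrier f ∘ₗ M.coact

theorem EntwinedModule.coact_act (M : E.EntwinedModule) (f : C →ₗ[R] A) (m : M.carrier) :
    M.coact (M.act f m) =
      (TensorProduct.lift (rightMul R A M.carrier)).rTensor C
        ((TensorProduct.assoc R M.carrier A C).symm
          ((E.sharpTwist f).lTensor M.carrier (M.coact m))) := by
  have h1 (x : M.carrier ⊗[R] C) : M.coact (evalAt M.carrier f x) =
      E.twist M.carrier (f.lTensor _ (M.coact.rTensor C x)) := by
    induction x with
    | zero => simp
    | add y z hy hz => simp only [map_add, hy, hz]
    | tmul n c => simp [M.compat]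
  have h2 : M.coact.rTensor C (M.coact m) = (TensorProduct.assoc R M.carrier C C).symm
      ((Coalgebra.comul (R := R) (A := C)).lTensor M.carrier (M.coact m)) := by
    rw [LinearEquiv.eq_symm_apply, M.coassoc]
  change M.coact (evalAt M.carrier f (M.coact m)) = _
  rw [h1, h2]
  induction M.coact m with
  | zero => simp
  | add y z hy hz => simp only [map_add, hy, hz]
  | tmul n c =>
    simp only [LinearMap.lTensor_tmul, sharpTwist, LinearMap.comp_apply]
    induction Coalgebra.comul (R := R) c with
    | zero => simp
    | add y z hy hz => simp only [TensorProduct.tmul_add, map_add, hy, hz]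
    | tmul a b =>
      rw [TensorProduct.assoc_symm_tmul, LinearMap.lTensor_tmul, LinearMap.lTensor_tmul,
        twist_tmul]
      induction E.psi (a ⊗ₜ f b) with
      | zero => simp
      | add y z hy hz => simp only [TensorProduct.tmul_add, map_add, hy, hz]
      | tmul a' c' => simp

theorem EntwinedModule.act_act (M : E.EntwinedModule) (f g : C →ₗ[R] A) (m : M.carrier) :
    M.act g (M.act f m) = M.act (E.sharpMul f g) m := by
  change evalAt M.carrier g (M.coact (M.act f m)) = evalAt M.carrier _ (M.coact m)
  rw [M.coact_act]
  induction M.coact m with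
  | zero => simp
  | add y z hy hz => simp only [map_add, hy, hz]
  | tmul n c =>
    simp only [LinearMap.lTensor_tmul, evalAt_tmul, sharpMul, LinearMap.comp_apply]
    induction E.sharpTwist f c with
    | zero => simp
    | add y z hy hz => simp only [TensorProduct.tmul_add, map_add, MulOpposite.op_add, add_smul,
        hy, hz]
    | tmul a' c' => simp [mul_smul]

theorem EntwinedModule.act_const (M : E.EntwinedModule) (a : A) (m : M.carrier) :
    M.act (sharpConst a) m = op a • m := by
  change evalAt M.carrier (sharpConst a) (M.coact m) = _
  rw [evalAt_sharpConst, M.counit]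

theorem EntwinedModule.act_one (M : E.EntwinedModule) (m : M.carrier) :
    M.act (sharpConst 1) m = m := by
  rw [EntwinedModule.act_const, MulOpposite.op_one, one_smul]

/-- The counit `a ⊗ c ↦ a ε(c)` of `A ⊗ C`. -/
def cofreeCounit : E.Cofree A →ₗ[R] A :=
  (TensorProduct.rid R A).toLinearMap ∘ₗ (Coalgebra.counit (R := R) (A := C)).lTensor A ∘ₗ
    (E.toCofree A).symm.toLinearMap

/-- The right action of a linear map `f : C → A` on `A ⊗ C`. -/
def cofreeAct (f : C →ₗ[R] A) : E.Cofree A →ₗ[R] E.Cofree A := (E.cofree A).act f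

theorem cofreeAct_cofreeAct (f g : C →ₗ[R] A) (x : E.Cofree A) :
    E.cofreeAct g (E.cofreeAct f x) = E.cofreeAct (E.sharpMul f g) x :=
  EntwinedModule.act_act E (E.cofree A) f g x

theorem cofreeAct_one (x : E.Cofree A) : E.cofreeAct (sharpConst 1) x = x :=
  EntwinedModule.act_one E (E.cofree A) x

theorem cofreeAct_one_tmul (f : C →ₗ[R] A) (c : C) :
    E.cofreeAct f (E.toCofree A (1 ⊗ₜ c)) = E.toCofree A (E.sharpTwist f c) := by
  change evalAt (E.Cofree A) f (E.cofreeCoact A (E.toCofree A (1 ⊗ₜ c))) = _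
  rw [cofreeCoact_toCofree, LinearMap.lTensor_tmul]
  simp only [sharpTwist, LinearMap.comp_apply]
  induction Coalgebra.comul (R := R) c with
  | zero => simp
  | add y z hy hz => simp only [TensorProduct.tmul_add, map_add, hy, hz]
  | tmul a b =>
    rw [TensorProduct.assoc_symm_tmul, LinearMap.rTensor_tmul, evalAt_tmul, LinearEquiv.coe_coe,
      op_smul_toCofree, twist_tmul, LinearMap.lTensor_tmul]
    congr 1
    induction E.psi (a ⊗ₜ f b) with
    | zero => simp
    | add y z hy hz => simp only [map_add, hy, hz]
    | tmul a' c' => simp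

theorem cofreeCounit_cofreeAct (f : C →ₗ[R] A) (x : A ⊗[R] C) :
    E.cofreeCounit (E.cofreeAct f (E.toCofree A x)) = evalAt A f x := by
  induction x with
  | zero => simp
  | add y z hy hz => simp only [map_add, hy, hz]
  | tmul a c =>
    have h1 : evalAt A f (a ⊗ₜ c) = a * TensorProduct.rid R A
        ((Coalgebra.counit (R := R) (A := C)).lTensor A (E.sharpTwist f c)) := by
      rw [counit_sharpTwist]; simp
    have h2 : E.cofreeAct f (E.toCofree A (a ⊗ₜ c)) =
        E.toCofree A ((LinearMap.mulLeft R a).rTensor C (E.sharpTwist f c)) := by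
      change evalAt (E.Cofree A) f (E.cofreeCoact A (E.toCofree A (a ⊗ₜ c))) = _
      rw [cofreeCoact_toCofree, LinearMap.lTensor_tmul]
      simp only [sharpTwist, LinearMap.comp_apply]
      induction Coalgebra.comul (R := R) c with
      | zero => simp
      | add y z hy hz => simp only [TensorProduct.tmul_add, map_add, hy, hz]
      | tmul d b =>
        rw [TensorProduct.assoc_symm_tmul, LinearMap.rTensor_tmul, evalAt_tmul,
          LinearEquiv.coe_coe, op_smul_toCofree, twist_tmul, LinearMap.lTensor_tmul]
        rfl
    rw [h1, h2]
    change TensorProduct.rid R A ((Coalgebra.counit (R := R) (A := C)).lTensor A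
      ((LinearMap.mulLeft R a).rTensor C (E.sharpTwist f c))) = _
    induction E.sharpTwist f c with
    | zero => simp
    | add y z hy hz => simp only [map_add, hy, hz, mul_add]
    | tmul a' c' => simp

theorem sharpMul_const (f : C →ₗ[R] A) (a : A) (c : C) :
    E.sharpMul f (sharpConst a) c = f c * a := by
  change evalAt A (sharpConst a) (E.sharpTwist f c) = _
  rw [evalAt_sharpConst, counit_sharpTwist]; rfl

theorem sharpMul_one (f : C →ₗ[R] A) : E.sharpMul f (sharpConst 1) = f := by
  ext c; rw [sharpMul_const, mul_one]

theorem sharpMul_eq (f g : C →ₗ[R] A) (c : C) :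
    E.sharpMul f g c =
      E.cofreeCounit (E.cofreeAct g (E.cofreeAct f (E.toCofree A (1 ⊗ₜ c)))) := by
  rw [cofreeAct_one_tmul, cofreeCounit_cofreeAct]; rfl

theorem one_sharpMul (f : C →ₗ[R] A) : E.sharpMul (sharpConst 1) f = f := by
  ext c
  rw [sharpMul_eq, cofreeAct_one, cofreeCounit_cofreeAct]
  simp

theorem sharpMul_assoc (f g h : C →ₗ[R] A) :
    E.sharpMul (E.sharpMul f g) h = E.sharpMul f (E.sharpMul g h) := by
  ext c
  rw [sharpMul_eq, sharpMul_eq, ← cofreeAct_cofreeAct, ← cofreeAct_cofreeAct]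

/-- The ring `#^op_ψ(C, A)`: the group `Hom_R(C, A)` with the product
`(f · g)(c) = ∑ f(c₂)_ψ g(c₁^ψ)` and unit `c ↦ ε(c) 1`. -/
def Sharp (_E : EntwiningStructure R A C) : Type u := C →ₗ[R] A

instance : AddCommGroup E.Sharp := inferInstanceAs (AddCommGroup (C →ₗ[R] A))

/-- The identity `Hom_R(C, A) → #^op_ψ(C, A)`. -/
def toSharp : (C →ₗ[R] A) ≃+ E.Sharp := AddEquiv.refl (C →ₗ[R] A)

/-- The linear map underlying an element of `#^op_ψ(C, A)`. -/
def ofSharp : E.Sharp ≃+ (C →ₗ[R] A) := AddEquiv.refl (C →ₗ[R] A)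

theorem evalAt_add (M : Type u) [AddCommGroup M] [Module R M] [Module Aᵐᵒᵖ M]
    [IsScalarTower R Aᵐᵒᵖ M] (f g : C →ₗ[R] A) (x : M ⊗[R] C) :
    evalAt M (f + g) x = evalAt M f x + evalAt M g x := by
  induction x with
  | zero => simp
  | add y z hy hz => rw [map_add, map_add, map_add, hy, hz]; abel
  | tmul m c => simp [add_smul]

theorem add_sharpMul (f g h : C →ₗ[R] A) :
    E.sharpMul (f + g) h = E.sharpMul f h + E.sharpMul g h := by
  ext c
  simp [sharpMul, sharpTwist, LinearMap.lTensor_add]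

theorem sharpMul_add (f g h : C →ₗ[R] A) :
    E.sharpMul f (g + h) = E.sharpMul f g + E.sharpMul f h :=
  LinearMap.ext fun c => evalAt_add A g h (E.sharpTwist f c)

instance : Ring E.Sharp where
  __ := (inferInstance : AddCommGroup E.Sharp)
  mul f g := E.toSharp (E.sharpMul (E.ofSharp f) (E.ofSharp g))
  one := E.toSharp (sharpConst 1)
  mul_assoc f g h := E.sharpMul_assoc (E.ofSharp f) (E.ofSharp g) (E.ofSharp h)
  one_mul f := E.one_sharpMul (E.ofSharp f)
  mul_one f := E.sharpMul_one (E.ofSharp f)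
  left_distrib f g h := E.sharpMul_add (E.ofSharp f) (E.ofSharp g) (E.ofSharp h)
  right_distrib f g h := E.add_sharpMul (E.ofSharp f) (E.ofSharp g) (E.ofSharp h)
  zero_mul f := by
    have h := E.add_sharpMul 0 0 (E.ofSharp f)
    rw [add_zero] at h
    exact left_eq_add.mp h
  mul_zero f := by
    have h := E.sharpMul_add (E.ofSharp f) 0 0
    rw [add_zero] at h
    exact left_eq_add.mp h

/-- The ring homomorphism `A → #^op_ψ(C, A)`, `a ↦ (c ↦ ε(c) a)`. -/
def ofA : A →+* E.Sharp where
  toFun a := E.toSharp (sharpConst a)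
  map_one' := rfl
  map_mul' a b := by
    refine LinearMap.ext fun c => ?_
    refine Eq.trans ?_ (E.sharpMul_const (sharpConst a) b c).symm
    exact (smul_mul_assoc (Coalgebra.counit (R := R) c) a b).symm
  map_zero' := by
    exact LinearMap.ext fun c => smul_zero (Coalgebra.counit (R := R) c)
  map_add' a b := by
    exact LinearMap.ext fun c => smul_add (Coalgebra.counit (R := R) c) a b

/-- Entwined modules are right `#^op_ψ(C, A)`-modules by `m f = ∑ m₀ f(m₁)`. -/
instance (M : E.EntwinedModule) : Module E.Sharpᵐᵒᵖ M.carrier where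
  smul f m := M.act (E.ofSharp (unop f)) m
  one_smul m := EntwinedModule.act_one E M m
  mul_smul f g m := (EntwinedModule.act_act E M (E.ofSharp (unop g)) (E.ofSharp (unop f)) m).symm
  smul_zero f := map_zero (M.act _)
  smul_add f m n := map_add (M.act _) m n
  add_smul f g m := evalAt_add M.carrier (E.ofSharp (unop f)) (E.ofSharp (unop g)) (M.coact m)
  zero_smul m := by
    have h := evalAt_add M.carrier (0 : C →ₗ[R] A) 0 (M.coact m)
    rw [add_zero] at h
    exact left_eq_add.mp h

theorem op_smul_entwined (M : E.EntwinedModule) (f : E.Sharp) (m : M.carrier) :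
    op f • m = evalAt M.carrier (E.ofSharp f) (M.coact m) := rfl

/-- The functor from entwined modules to right `#^op_ψ(C, A)`-modules which is the identity on
underlying groups and maps, with `m f = ∑ m₀ f(m₁)`. -/
def toSharpModule : E.EntwinedModule ⥤ ModuleCat.{u} E.Sharpᵐᵒᵖ where
  obj M := ModuleCat.of E.Sharpᵐᵒᵖ M.carrier
  map {M N} φ := ModuleCat.ofHom
    { toFun := φ.toLinearMap
      map_add' := map_add φ.toLinearMap
      map_smul' := fun f m => by
        obtain ⟨f, rfl⟩ := MulOpposite.op_surjective f
        simp only [RingHom.id_apply]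
        rw [op_smul_entwined, op_smul_entwined, φ.colinear]
        induction M.coact m with
        | zero => simp
        | add y z hy hz => simp only [map_add, hy, hz]
        | tmul n c => simp }
  map_id _ := rfl
  map_comp _ _ := rfl

/-- The right `#^op_ψ(C, A)`-module `A ⊗ C`, with `(a ⊗ c) f = ∑ a f(c₂)_ψ ⊗ c₁^ψ`. -/
def coringModule : ModuleCat.{u} E.Sharpᵐᵒᵖ := E.toSharpModule.obj (E.cofree A)

/-- The `α`-condition: for every right `A`-module `M` the map
`M ⊗ C → Hom(#^op_ψ(C, A), M)`, `m ⊗ c ↦ (f ↦ m f(c))`, is injective. -/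
def AlphaCondition (_E : EntwiningStructure R A C) : Prop :=
  ∀ (M : Type u) [AddCommGroup M] [Module R M] [Module Aᵐᵒᵖ M] [IsScalarTower R Aᵐᵒᵖ M],
    Function.Injective (fun (x : M ⊗[R] C) (f : C →ₗ[R] A) => evalAt M f x)

/-- A right `#^op_ψ(C, A)`-module regarded as an `R`-module and a right `A`-module by restriction
of scalars along `A → #^op_ψ(C, A)`, `a ↦ (c ↦ ε(c) a)`. -/
def Restrict (M : ModuleCat.{u} E.Sharpᵐᵒᵖ) : Type u := M

section

variable (M : ModuleCat.{u} E.Sharpᵐᵒᵖ)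

instance : AddCommGroup (E.Restrict M) := inferInstanceAs (AddCommGroup M)

instance : Module E.Sharpᵐᵒᵖ (E.Restrict M) := inferInstanceAs (Module E.Sharpᵐᵒᵖ M)

instance : Module Aᵐᵒᵖ (E.Restrict M) := Module.compHom (E.Restrict M) (RingHom.op E.ofA)

instance : Module R (E.Restrict M) := Module.compHom (E.Restrict M) (algebraMap R Aᵐᵒᵖ)

instance : IsScalarTower R Aᵐᵒᵖ (E.Restrict M) where
  smul_assoc r a m := by
    rw [Algebra.smul_def, mul_smul]
    rfl

/-- The rational part `Rat^C(M)` of a right `#^op_ψ(C, A)`-module `M`: the elements `m` for which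
there is `∑ mᵢ ⊗ cᵢ ∈ M ⊗ C` with `m f = ∑ mᵢ f(cᵢ)` for all `f`. -/
def rationalPart : Set (E.Restrict M) :=
  {m | ∃ x : E.Restrict M ⊗[R] C, ∀ f : E.Sharp, op f • m = evalAt (E.Restrict M) (E.ofSharp f) x}

end

/-- The category `Rat^C(M_{#^op_ψ(C, A)})` of `#`-rational right `#^op_ψ(C, A)`-modules `M`, i.e.
those with `Rat^C(M) = M`, as a property of right `#^op_ψ(C, A)`-modules. -/
def IsRational : ObjectProperty (ModuleCat.{u} E.Sharpᵐᵒᵖ) := fun M =>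
  E.rationalPart M = Set.univ

end Sharp

end EntwiningStructure

end

/-!
A coaction is determined by the `A`-linear map `M → M ⊗ C`, and entwined modules are the coalgebras
over the comonad `- ⊗ C` on right `A`-modules. If this comonad is left exact, the forgetful functor
to right `A`-modules creates finite limits and all colimits, so exactness of filtered colimits is
inherited from `A`-modules. Every element of an entwined module `M ⊆ M ⊗ C` lies in the image of
some `A^(ℕ) ⊗ C → M ⊗ C`, so it lies in the image of a submodule of `A^(ℕ) ⊗ C`; hence the
submodules of this single entwined module generate.

For the comparison with `#^op_ψ(C, A)`-modules, the `α`-condition says that an element of `M ⊗ C` is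
known from its values under all `f : C → A`. Comodule identities can thus be checked after
evaluation, where they become the module axioms over `#^op_ψ(C, A)`. Applied to the quotient by a
submodule, the same condition shows that submodules of rational modules are rational. When `C` is
finitely generated and projective, a dual basis `(eₖ, pₖ)` gives `m f = ∑ (m pₖ) f(eₖ)`, so every
module is rational.
-/

noncomputable section

section Category

open Limits

variable {𝒞 : Type v} {𝒟 : Type w} [Category.{v'} 𝒞] [Category.{w'} 𝒟]

/-- A preadditive category with finite limits and colimits is abelian if it has an exact
functor reflecting isomorphisms to an abelian category. This is a definition because an abelian
structure is data. -/
@[reducible] def abelianOfExactConservative [Preadditive 𝒞] [Abelian 𝒟] [HasFiniteLimits 𝒞]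
    [HasFiniteColimits 𝒞] (F : 𝒞 ⥤ 𝒟) [F.PreservesZeroMorphisms] [PreservesFiniteLimits F]
    [PreservesFiniteColimits F] [F.ReflectsIsomorphisms] : Abelian 𝒞 := by
  have : HasFiniteProducts 𝒞 := inferInstance
  have (X Y : 𝒞) (f : X ⟶ Y) : IsIso (Abelian.coimageImageComparison f) := by
    have : IsIso (F.map (Abelian.coimageImageComparison f)) :=
      (Arrow.isIso_iff_isIso_of_isIso
        (Abelian.PreservesCoimageImageComparison.iso F f).hom).2 inferInstance
    exact isIso_of_reflects_iso _ F
  exact Abelian.ofCoimageImageComparisonIsIso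

theorem le_of_mk_map_arrow_le [HasPullbacks 𝒞] (F : 𝒞 ⥤ 𝒟)
    [PreservesLimitsOfShape WalkingCospan F] [F.ReflectsIsomorphisms] {X : 𝒞} {S T : Subobject X}
    (h : Subobject.mk (F.map S.arrow) ≤ Subobject.mk (F.map T.arrow)) : S ≤ T := by
  let hP := (IsPullback.of_hasPullback S.arrow T.arrow).map F
  have : IsSplitEpi (F.map (pullback.fst S.arrow T.arrow)) :=
    ⟨⟨⟨hP.lift (𝟙 _) (Subobject.ofMkLEMk _ _ h) (by simp), hP.lift_fst _ _ _⟩⟩⟩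
  have : IsIso (F.map (pullback.fst S.arrow T.arrow)) := isIso_of_mono_of_isSplitEpi _
  have := isIso_of_reflects_iso (pullback.fst S.arrow T.arrow) F
  exact Subobject.le_of_comm (inv (pullback.fst S.arrow T.arrow) ≫ pullback.snd _ _) (by
    rw [Category.assoc, ← pullback.condition, IsIso.inv_hom_id_assoc])

theorem wellPowered_of_reflectsIsomorphisms [HasPullbacks 𝒞] [LocallySmall.{u} 𝒞]
    [LocallySmall.{u} 𝒟] [WellPowered.{u} 𝒟] (F : 𝒞 ⥤ 𝒟) [PreservesLimitsOfShape WalkingCospan F]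
    [F.ReflectsIsomorphisms] : WellPowered.{u} 𝒞 where
  subobject_small X := small_of_injective
    (f := fun S : Subobject X => Subobject.mk (F.map S.arrow)) fun _ _ h =>
      le_antisymm (le_of_mk_map_arrow_le F h.le) (le_of_mk_map_arrow_le F h.ge)

theorem hasSeparator_of_lifts_through_subobjects {𝒞 : Type v} [Category.{u} 𝒞]
    [HasZeroMorphisms 𝒞] [HasPullbacks 𝒞] [HasCoproducts.{u} 𝒞] [WellPowered.{u} 𝒞] (F : 𝒞 ⥤ 𝒟)
    [F.Faithful] [PreservesLimitsOfShape WalkingCospan F] {P : 𝒟} (hP : IsSeparator P) (K : 𝒞)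
    (hK : ∀ (X : 𝒞) (x : P ⟶ F.obj X), ∃ (Y : 𝒞) (i : X ⟶ Y) (_ : Mono i) (k : K ⟶ Y)
      (z : P ⟶ F.obj K), z ≫ F.map k = x ≫ F.map i) :
    HasSeparator 𝒞 where
  hasSeparator := by
    let T (S : Shrink.{u} (Subobject K)) : 𝒞 := ((equivShrink.{u} (Subobject K)).symm S : 𝒞)
    refine ⟨∐ T, (isSeparator_sigma T).2 fun X Y f g hfg => F.map_injective ?_⟩
    refine hP.def _ _ fun x => ?_
    obtain ⟨Z, i, _, k, z, hz⟩ := hK X x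
    let S : Subobject K := Subobject.mk (pullback.snd i k)
    have hST : (S : 𝒞) ≅ T (equivShrink _ S) := eqToIso (by simp [T])
    have hfst : pullback.fst i k ≫ f = pullback.fst i k ≫ g := by
      have := hfg _ (ObjectProperty.ofObj_apply T (equivShrink _ S))
        (hST.inv ≫ (Subobject.underlyingIso (pullback.snd i k)).hom ≫ pullback.fst i k)
      simpa using this
    have hpb := (IsPullback.of_hasPullback i k).map F
    rw [← hpb.lift_fst x z hz.symm, Category.assoc, Category.assoc, ← F.map_comp, hfst, F.map_comp]

theorem reflectsIsomorphisms_of_comonadic (F : 𝒞 ⥤ 𝒟) [ComonadicLeftAdjoint F] :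
    F.ReflectsIsomorphisms :=
  inferInstanceAs ((Comonad.comparison (comonadicAdjunction F) ⋙
    (comonadicAdjunction F).toComonad.forget).ReflectsIsomorphisms)

theorem hasColimitsOfSize_of_comonadic (F : 𝒞 ⥤ 𝒟) [ComonadicLeftAdjoint F]
    [HasColimitsOfSize.{u, u} 𝒟] : HasColimitsOfSize.{u, u} 𝒞 :=
  have := comonadicCreatesColimits.{u, u} F
  hasColimits_of_hasColimits_createsColimits F

/-- A comonadic functor whose comonad is left exact creates finite limits. -/
@[reducible] def createsFiniteLimitsOfComonadic (F : 𝒞 ⥤ 𝒟) [ComonadicLeftAdjoint F]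
    [PreservesFiniteLimits (comonadicRightAdjoint F ⋙ F)] :
    CreatesFiniteLimits F where
  createsFiniteLimits _ _ _ := ⟨fun {K} => comonadicCreatesLimitOfPreservesLimit F K⟩

theorem hasFiniteLimits_of_comonadic [HasFiniteLimits 𝒟] (F : 𝒞 ⥤ 𝒟) [ComonadicLeftAdjoint F]
    [PreservesFiniteLimits (comonadicRightAdjoint F ⋙ F)] : HasFiniteLimits 𝒞 :=
  have := createsFiniteLimitsOfComonadic F
  ⟨fun _ _ _ => hasLimitsOfShape_of_hasLimitsOfShape_createsLimitsOfShape F⟩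

theorem preservesFiniteLimits_of_comonadic [HasFiniteLimits 𝒟] (F : 𝒞 ⥤ 𝒟)
    [ComonadicLeftAdjoint F] [PreservesFiniteLimits (comonadicRightAdjoint F ⋙ F)] :
    PreservesFiniteLimits F :=
  have := createsFiniteLimitsOfComonadic F
  inferInstance

/-- A category that is comonadic over an abelian category is abelian if the comonad is left
exact. -/
@[reducible] def abelianOfComonadic (F : 𝒞 ⥤ 𝒟) [ComonadicLeftAdjoint F] [Abelian 𝒟]
    [HasFiniteColimits 𝒞] [PreservesFiniteLimits (comonadicRightAdjoint F ⋙ F)] :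
    Abelian 𝒞 := by
  have : (comonadicAdjunction F).toComonad.toFunctor.Additive :=
    Functor.additive_of_preserves_binary_products (comonadicRightAdjoint F ⋙ F)
  letI : Preadditive 𝒞 :=
    .ofFullyFaithful (.ofFullyFaithful (Comonad.comparison (comonadicAdjunction F)))
  have : F.ReflectsIsomorphisms := reflectsIsomorphisms_of_comonadic F
  have : HasFiniteLimits 𝒞 := hasFiniteLimits_of_comonadic F
  have : PreservesFiniteLimits F := preservesFiniteLimits_of_comonadic F
  have : PreservesColimitsOfSize.{0, 0} F :=
    (comonadicAdjunction F).leftAdjoint_preservesColimits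
  exact abelianOfExactConservative F

theorem isGrothendieckAbelian_of_comonadic (F : 𝒞 ⥤ 𝒟) [ComonadicLeftAdjoint F]
    [Abelian 𝒞] [Abelian 𝒟] [PreservesFiniteLimits (comonadicRightAdjoint F ⋙ F)]
    [IsGrothendieckAbelian.{u} 𝒟] [LocallySmall.{u} 𝒞] [HasSeparator 𝒞] :
    IsGrothendieckAbelian.{u} 𝒞 := by
  have : F.ReflectsIsomorphisms := reflectsIsomorphisms_of_comonadic F
  have : HasColimitsOfSize.{u, u} 𝒞 := hasColimitsOfSize_of_comonadic F
  have : PreservesFiniteLimits F := preservesFiniteLimits_of_comonadic F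
  have : PreservesColimitsOfSize.{u, u} F :=
    (comonadicAdjunction F).leftAdjoint_preservesColimits
  have : ReflectsFiniteLimits F := ⟨fun _ _ _ => reflectsLimitsOfShape_of_reflectsIsomorphisms⟩
  exact { ab5OfSize := { ofShape J _ _ := HasExactColimitsOfShape.domain_of_functor J F } }

theorem isSeparator_moduleCat_self (S : Type u) [Ring S] : IsSeparator (ModuleCat.of S S) :=
  (isSeparator_def _).2 fun X _ f g h => ModuleCat.hom_ext <| LinearMap.ext fun x => by
    simpa using LinearMap.congr_fun (congrArg ModuleCat.Hom.hom
      (h (ModuleCat.ofHom (LinearMap.toSpanSingleton S X x)))) 1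

end Category

theorem exists_rTensor_finsupp_eq {R M C : Type*} (S : Type*) [CommRing R] [Ring S] [Algebra R S]
    [AddCommGroup M] [Module R M] [Module S M] [IsScalarTower R S M] [AddCommGroup C] [Module R C]
    (x : M ⊗[R] C) :
    ∃ (φ : (ℕ →₀ S) →ₗ[S] M) (y : (ℕ →₀ S) ⊗[R] C), (φ.restrictScalars R).rTensor C y = x := by
  obtain ⟨n, m, c, rfl⟩ := TensorProduct.exists_sum_tmul_eq x
  refine ⟨Finsupp.linearCombination S (Function.extend Fin.val m 0),
    ∑ j : Fin n, Finsupp.single (j : ℕ) 1 ⊗ₜ c j, ?_⟩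
  simp [Fin.val_injective.extend_apply]

section Evaluation

variable {R A C : Type u} [CommRing R] [Ring A] [Algebra R A] [AddCommGroup C] [Module R C]
  {M N : Type u} [AddCommGroup M] [Module R M] [Module Aᵐᵒᵖ M] [IsScalarTower R Aᵐᵒᵖ M]
  [AddCommGroup N] [Module R N] [Module Aᵐᵒᵖ N] [IsScalarTower R Aᵐᵒᵖ N]

theorem evalAt_rTensor (f : C →ₗ[R] A) (φ : M →ₗ[Aᵐᵒᵖ] N) (x : M ⊗[R] C) :
    evalAt N f ((φ.restrictScalars R).rTensor C x) = φ (evalAt M f x) := by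
  induction x with
  | zero => simp
  | add y z hy hz => simp only [map_add, hy, hz]
  | tmul m c => simp

theorem finsuppScalarRight_lTensor {ι : Type*} [DecidableEq ι] (g : C →ₗ[R] ι →₀ R)
    (x : M ⊗[R] C) (i : ι) :
    TensorProduct.finsuppScalarRight R R M ι (g.lTensor M x) i =
      evalAt M ((Finsupp.lapply i ∘ₗ g).smulRight (1 : A)) x := by
  induction x with
  | zero => simp
  | add y z hy hz => simp only [map_add, Finsupp.add_apply, hy, hz]
  | tmul m c => simp [TensorProduct.finsuppScalarRight_apply_tmul_apply]

end Evaluation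

namespace IsLocallyProjective

variable {R A C : Type u} [CommRing R] [Ring A] [Algebra R A] [AddCommGroup C] [Module R C]

theorem of_projective [Module.Projective R C] : IsLocallyProjective R C := by
  intro F _ L N _ _ _ _ p g hp
  obtain ⟨g', hg'⟩ := Module.projective_lifting_property p g hp
  exact ⟨g', fun x _ => LinearMap.congr_fun hg' x⟩

theorem eq_zero_of_evalAt_eq_zero (h : IsLocallyProjective R C) {M : Type u} [AddCommGroup M]
    [Module R M] [Module Aᵐᵒᵖ M] [IsScalarTower R Aᵐᵒᵖ M] {x : M ⊗[R] C}
    (hx : ∀ f : C →ₗ[R] A, evalAt M f x = 0) : x = 0 := by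
  classical
  obtain ⟨F, hF, hxF⟩ := TensorProduct.exists_finite_submodule_right_of_setFinite {x}
    (Set.finite_singleton x)
  obtain ⟨y, rfl⟩ := hxF rfl
  let p := Finsupp.linearCombination R (id : C → C)
  obtain ⟨g, hg⟩ := h F (Module.Finite.iff_fg.1 hF) (C →₀ R) C p LinearMap.id
    (Finsupp.linearCombination_id_surjective R C)
  have hpg : p ∘ₗ g ∘ₗ F.subtype = F.subtype := LinearMap.ext fun c => hg c c.2
  have hgy : g.lTensor M (F.subtype.lTensor M y) = 0 :=
    (TensorProduct.finsuppScalarRight R R M C).injective <| Finsupp.ext fun i => by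
      rw [finsuppScalarRight_lTensor (A := A), hx, map_zero, Finsupp.zero_apply]
  rw [← hpg, LinearMap.lTensor_comp_apply, LinearMap.lTensor_comp_apply, hgy, map_zero]

end IsLocallyProjective

namespace EntwiningStructure

variable {R A C : Type u} [CommRing R] [Ring A] [Algebra R A]
  [AddCommGroup C] [Module R C] [Coalgebra R C] {E : EntwiningStructure R A C}

theorem alphaCondition_of_isLocallyProjective (h : IsLocallyProjective R C) :
    E.AlphaCondition := fun M _ _ _ _ x y hxy =>
  sub_eq_zero.1 <| h.eq_zero_of_evalAt_eq_zero fun f => by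
    rw [map_sub, sub_eq_zero]
    exact congrFun hxy f

section Cofree

variable {M N P : Type u} [AddCommGroup M] [Module R M] [Module Aᵐᵒᵖ M] [IsScalarTower R Aᵐᵒᵖ M]
  [AddCommGroup N] [Module R N] [Module Aᵐᵒᵖ N] [IsScalarTower R Aᵐᵒᵖ N]
  [AddCommGroup P] [Module R P] [Module Aᵐᵒᵖ P] [IsScalarTower R Aᵐᵒᵖ P]

theorem AlphaCondition.ext (hα : E.AlphaCondition) {x y : M ⊗[R] C}
    (h : ∀ f : C →ₗ[R] A, evalAt M f x = evalAt M f y) : x = y :=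
  hα M (funext h)

theorem AlphaCondition.exists_rTensor_eq_of_exact (hα : E.AlphaCondition) {φ : M →ₗ[Aᵐᵒᵖ] N}
    {π : N →ₗ[Aᵐᵒᵖ] P} (hexact : Function.Exact φ π) (hπ : Function.Surjective π) {x : N ⊗[R] C}
    (hx : ∀ f : C →ₗ[R] A, evalAt N f x ∈ Set.range φ) :
    ∃ y, (φ.restrictScalars R).rTensor C y = x := by
  refine (rTensor_exact C (f := φ.restrictScalars R) (g := π.restrictScalars R) hexact hπ x).1
    (hα.ext fun f => ?_)
  rw [evalAt_rTensor, map_zero]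
  exact (hexact _).2 (hx f)

variable (E)

theorem sharpTwist_sharpConst (a : A) (c : C) :
    E.sharpTwist (sharpConst a) c = E.psi (c ⊗ₜ a) := by
  have h : (sharpConst (R := R) (C := C) a) =
      LinearMap.toSpanSingleton R A a ∘ₗ Coalgebra.counit := rfl
  rw [sharpTwist, h, LinearMap.lTensor_comp, LinearMap.comp_apply, LinearMap.comp_apply,
    LinearMap.comp_apply, Coalgebra.lTensor_counit_comul, LinearMap.lTensor_tmul,
    LinearMap.toSpanSingleton_apply, one_smul]

theorem evalAt_twist (f : C →ₗ[R] A) (a : A) (x : M ⊗[R] C) :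
    evalAt M f (E.twist M (x ⊗ₜ a)) = evalAt M (E.sharpMul (sharpConst a) f) x := by
  induction x with
  | zero => simp
  | add y z hy hz => simp only [map_add, hy, hz, TensorProduct.add_tmul]
  | tmul m c =>
    rw [twist_tmul, evalAt_tmul, sharpMul, LinearMap.comp_apply, sharpTwist_sharpConst]
    induction E.psi (c ⊗ₜ a) with
    | zero => simp
    | add y z hy hz => simp only [map_add, hy, hz, MulOpposite.op_add, add_smul]
    | tmul b d => simp [mul_smul]

theorem twist_rTensor (f : M →ₗ[Aᵐᵒᵖ] N) (x : M ⊗[R] C) (a : A) :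
    E.twist N ((f.restrictScalars R).rTensor C x ⊗ₜ a) =
      (f.restrictScalars R).rTensor C (E.twist M (x ⊗ₜ a)) := by
  have h (m : M) : f.restrictScalars R ∘ₗ rightMul R A M m = rightMul R A N (f m) :=
    LinearMap.ext fun b => f.map_smul (op b) m
  induction x with
  | zero => simp
  | add y z hy hz => simp only [TensorProduct.add_tmul, map_add, hy, hz]
  | tmul m c =>
    rw [LinearMap.rTensor_tmul, twist_tmul, twist_tmul, ← LinearMap.rTensor_comp_apply, h]
    rfl

/-- The map `f ⊗ C : M ⊗ C → N ⊗ C` for an `A`-linear map `f : M → N`, which is `A`-linear for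
the entwined actions. -/
def cofreeLinearMap (f : M →ₗ[Aᵐᵒᵖ] N) : E.Cofree M →ₗ[Aᵐᵒᵖ] E.Cofree N where
  toFun x := E.toCofree N ((f.restrictScalars R).rTensor C ((E.toCofree M).symm x))
  map_add' x y := by simp only [map_add]
  map_smul' a x := congrArg (E.toCofree N)
    (E.twist_rTensor f ((E.toCofree M).symm x) (unop a)).symm

variable {E}

theorem cofreeLinearMap_toCofree (f : M →ₗ[Aᵐᵒᵖ] N) (x : M ⊗[R] C) :
    E.cofreeLinearMap f (E.toCofree M x) =
      E.toCofree N ((f.restrictScalars R).rTensor C x) := rfl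

theorem cofreeLinearMap_comp_apply (g : N →ₗ[Aᵐᵒᵖ] P) (f : M →ₗ[Aᵐᵒᵖ] N) (x : E.Cofree M) :
    E.cofreeLinearMap (g ∘ₗ f) x = E.cofreeLinearMap g (E.cofreeLinearMap f x) :=
  LinearMap.rTensor_comp_apply C (g.restrictScalars R) (f.restrictScalars R)
    ((E.toCofree M).symm x)

theorem cofreeLinearMap_id_apply (x : E.Cofree M) :
    E.cofreeLinearMap (LinearMap.id : M →ₗ[Aᵐᵒᵖ] M) x = x :=
  LinearMap.rTensor_id_apply C M ((E.toCofree M).symm x)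

theorem cofreeLinearMap_add (f g : M →ₗ[Aᵐᵒᵖ] N) :
    E.cofreeLinearMap (f + g) = E.cofreeLinearMap f + E.cofreeLinearMap g :=
  LinearMap.ext fun x => LinearMap.congr_fun
    (LinearMap.rTensor_add C (f.restrictScalars R) (g.restrictScalars R)) ((E.toCofree M).symm x)

theorem cofreeCoact_cofreeLinearMap (f : M →ₗ[Aᵐᵒᵖ] N) (x : E.Cofree M) :
    E.cofreeCoact N (E.cofreeLinearMap f x) =
      ((E.cofreeLinearMap f).restrictScalars R).rTensor C (E.cofreeCoact M x) := by
  obtain ⟨x, rfl⟩ := (E.toCofree M).surjective x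
  rw [cofreeLinearMap_toCofree, cofreeCoact_toCofree, cofreeCoact_toCofree]
  induction x with
  | zero => simp
  | add y z hy hz => simp only [map_add, hy, hz]
  | tmul m c =>
    simp only [LinearMap.rTensor_tmul, LinearMap.lTensor_tmul]
    induction Coalgebra.comul (R := R) c with
    | zero => simp
    | add y z hy hz => simp only [TensorProduct.tmul_add, map_add, hy, hz]
    | tmul b d => simp [cofreeLinearMap_toCofree]

variable (E M) in
/-- The counit `m ⊗ c ↦ m ε(c)` of `M ⊗ C`, written as evaluation at the unit of
`#^op_ψ(C, A)`. -/
def counitLinearMap : E.Cofree M →ₗ[Aᵐᵒᵖ] M where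
  toFun x := evalAt M (sharpConst 1) ((E.toCofree M).symm x)
  map_add' x y := map_add (evalAt M (sharpConst 1)) ((E.toCofree M).symm x) ((E.toCofree M).symm y)
  map_smul' a x := by
    refine (E.evalAt_twist _ (unop a) ((E.toCofree M).symm x)).trans ?_
    rw [sharpMul_one, evalAt_sharpConst, evalAt_sharpConst, op_one, one_smul]
    rfl

theorem counitLinearMap_toCofree (x : M ⊗[R] C) : E.counitLinearMap M (E.toCofree M x) =
    TensorProduct.rid R M ((Coalgebra.counit (R := R) (A := C)).lTensor M x) :=
  (evalAt_sharpConst M 1 x).trans (one_smul _ _)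

theorem counitLinearMap_cofreeLinearMap (f : M →ₗ[Aᵐᵒᵖ] N) (x : E.Cofree M) :
    E.counitLinearMap N (E.cofreeLinearMap f x) = f (E.counitLinearMap M x) :=
  evalAt_rTensor _ f ((E.toCofree M).symm x)

theorem rTensor_counitLinearMap_cofreeCoact (x : E.Cofree M) :
    ((E.counitLinearMap M).restrictScalars R).rTensor C (E.cofreeCoact M x) =
      (E.toCofree M).symm x := by
  obtain ⟨x, rfl⟩ := (E.toCofree M).surjective x
  rw [cofreeCoact_toCofree, LinearEquiv.symm_apply_apply]
  induction x with
  | zero => simp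
  | add y z hy hz => simp only [map_add, hy, hz]
  | tmul m c =>
    have h (z : C ⊗[R] C) : ((E.counitLinearMap M).restrictScalars R).rTensor C
        ((E.toCofree M).toLinearMap.rTensor C ((TensorProduct.assoc R M C C).symm (m ⊗ₜ z))) =
        m ⊗ₜ TensorProduct.lid R C ((Coalgebra.counit (R := R) (A := C)).rTensor C z) := by
      induction z with
      | zero => simp
      | add y z hy hz => simp only [TensorProduct.tmul_add, map_add, hy, hz]
      | tmul a b => simp [counitLinearMap_toCofree, TensorProduct.smul_tmul]
    rw [LinearMap.lTensor_tmul, h, Coalgebra.rTensor_counit_comul, TensorProduct.lid_tmul,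
      one_smul]

theorem counitLinearMap_act (f : C →ₗ[R] A) (x : E.Cofree M) :
    E.counitLinearMap M ((E.cofree M).act f x) = evalAt M f ((E.toCofree M).symm x) := by
  rw [← rTensor_counitLinearMap_cofreeCoact, evalAt_rTensor]
  rfl

theorem evalAt_act_cofree (f g : C →ₗ[R] A) (x : E.Cofree M) :
    evalAt M g ((E.toCofree M).symm ((E.cofree M).act f x)) =
      evalAt M (E.sharpMul f g) ((E.toCofree M).symm x) :=
  (counitLinearMap_act g ((E.cofree M).act f x)).symm.trans <|
    (congrArg (E.counitLinearMap M) (EntwinedModule.act_act E (E.cofree M) f g x)).trans <|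
    counitLinearMap_act (E.sharpMul f g) x

/-- The morphism `f ⊗ C : M ⊗ C → N ⊗ C` of entwined modules for an `A`-linear map
`f : M → N`. -/
def cofreeMap (f : M →ₗ[Aᵐᵒᵖ] N) : E.cofree M ⟶ E.cofree N where
  toLinearMap := E.cofreeLinearMap f
  colinear := cofreeCoact_cofreeLinearMap f

/-- The entwined module with coaction `ρ : M → M ⊗ C`, where `ρ` is bundled as an `A`-linear map,
so that its compatibility with the entwining is part of its type. -/
def EntwinedModule.ofLinearMap (ρ : M →ₗ[Aᵐᵒᵖ] E.Cofree M)
    (coassoc : ∀ m, E.cofreeCoact M (ρ m) =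
      (ρ.restrictScalars R).rTensor C ((E.toCofree M).symm (ρ m)))
    (counit : ∀ m, E.counitLinearMap M (ρ m) = m) : E.EntwinedModule where
  carrier := M
  coact := (E.toCofree M).symm.toLinearMap ∘ₗ ρ.restrictScalars R
  coassoc m := by
    have h := congrArg ((E.toCofree M).symm.toLinearMap.rTensor C) (coassoc m)
    rw [← LinearMap.rTensor_comp_apply] at h
    rw [← LinearEquiv.eq_symm_apply]
    refine h.symm.trans ?_
    rw [cofreeCoact, LinearMap.comp_apply, ← LinearMap.rTensor_comp_apply, LinearEquiv.comp_coe,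
      LinearEquiv.self_trans_symm, LinearEquiv.refl_toLinearMap, LinearMap.rTensor_id_apply]
    rfl
  counit m := (counitLinearMap_toCofree ((E.toCofree M).symm (ρ m))).symm.trans (counit m)
  compat m a := congrArg (E.toCofree M).symm (ρ.map_smul (op a) m)

namespace EntwinedModule

/-- The coaction of an entwined module as an `A`-linear map `M → M ⊗ C`. -/
def coactLinearMap (M : E.EntwinedModule) : M.carrier →ₗ[Aᵐᵒᵖ] E.Cofree M.carrier where
  toFun m := E.toCofree M.carrier (M.coact m)
  map_add' x y := by simp only [map_add]
  map_smul' a x := congrArg (E.toCofree M.carrier) (M.compat x (unop a))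

/-- The coaction of an entwined module as a morphism `M → M ⊗ C` of entwined modules. -/
def coactHom (M : E.EntwinedModule) : M ⟶ E.cofree M.carrier where
  toLinearMap := M.coactLinearMap
  colinear m := by
    change E.cofreeCoact M.carrier (E.toCofree M.carrier (M.coact m)) =
      LinearMap.rTensor C ((E.toCofree M.carrier).toLinearMap ∘ₗ M.coact) (M.coact m)
    rw [cofreeCoact_toCofree, LinearMap.rTensor_comp_apply, ← M.coassoc,
      LinearEquiv.symm_apply_apply]

theorem counitLinearMap_coactLinearMap (M : E.EntwinedModule) (m : M.carrier) :
    E.counitLinearMap M.carrier (M.coactLinearMap m) = m :=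
  (counitLinearMap_toCofree (M.coact m)).trans (M.counit m)

theorem coactLinearMap_injective (M : E.EntwinedModule) :
    Function.Injective M.coactLinearMap :=
  Function.LeftInverse.injective M.counitLinearMap_coactLinearMap

theorem cofreeLinearMap_coactLinearMap {M N : E.EntwinedModule} (g : M ⟶ N) (m : M.carrier) :
    E.cofreeLinearMap g.toLinearMap (M.coactLinearMap m) = N.coactLinearMap (g.toLinearMap m) :=
  (g.colinear m).symm

end EntwinedModule

end Cofree

section Rational

variable {M M' : ModuleCat.{u} E.Sharpᵐᵒᵖ}

theorem restrict_smul_smul (f g : C →ₗ[R] A) (m : E.Restrict M) :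
    op (E.toSharp g) • op (E.toSharp f) • m = op (E.toSharp (E.sharpMul f g)) • m :=
  (mul_smul (op (E.toSharp g)) (op (E.toSharp f)) m).symm

/-- `x = ∑ mᵢ ⊗ cᵢ` represents the action on `m` if `m f = ∑ mᵢ f(cᵢ)` for all `f : C → A`; the
rational part of `M` consists of the elements having such an `x`. -/
def Represents (m : E.Restrict M) (x : E.Restrict M ⊗[R] C) : Prop :=
  ∀ f : C →ₗ[R] A, op (E.toSharp f) • m = evalAt (E.Restrict M) f x

theorem isRational_iff : E.IsRational M ↔ ∀ m : E.Restrict M, ∃ x, Represents m x :=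
  Set.eq_univ_iff_forall

/-- A `#`-linear map as an `A`-linear map. -/
def restrictMap (φ : M →ₗ[E.Sharpᵐᵒᵖ] M') : E.Restrict M →ₗ[Aᵐᵒᵖ] E.Restrict M' where
  toFun := φ
  map_add' := map_add φ
  map_smul' a m := φ.map_smul (op (E.ofA (unop a))) m

theorem restrictMap_sharp_smul (φ : M →ₗ[E.Sharpᵐᵒᵖ] M') (f : C →ₗ[R] A) (m : E.Restrict M) :
    restrictMap φ (op (E.toSharp f) • m) = op (E.toSharp f) • restrictMap φ m :=
  φ.map_smul (op (E.toSharp f)) m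

namespace Represents

theorem zero : Represents (0 : E.Restrict M) 0 := fun f => by
  rw [smul_zero, map_zero]

theorem add {m n : E.Restrict M} {x y : E.Restrict M ⊗[R] C} (hx : Represents m x)
    (hy : Represents n y) : Represents (m + n) (x + y) := fun f => by
  rw [smul_add, map_add, hx, hy]

theorem op_smul {m : E.Restrict M} {x : E.Restrict M ⊗[R] C} (hx : Represents m x) (a : A) :
    Represents (op a • m) (E.twist _ (x ⊗ₜ a)) := fun f => by
  rw [evalAt_twist, ← hx, ← restrict_smul_smul]
  rfl

theorem unique (hα : E.AlphaCondition) {m : E.Restrict M} {x y : E.Restrict M ⊗[R] C}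
    (hx : Represents m x) (hy : Represents m y) : x = y :=
  hα.ext fun f => by rw [← hx, ← hy]

theorem map (φ : M →ₗ[E.Sharpᵐᵒᵖ] M') {m : E.Restrict M} {x : E.Restrict M ⊗[R] C}
    (hx : Represents m x) :
    Represents (restrictMap φ m) (((restrictMap φ).restrictScalars R).rTensor C x) := fun f => by
  rw [evalAt_rTensor, ← hx, restrictMap_sharp_smul]

theorem exists_of_injective (hα : E.AlphaCondition) (φ : M →ₗ[E.Sharpᵐᵒᵖ] M')
    (hφ : Function.Injective φ) {m : E.Restrict M} {x : E.Restrict M' ⊗[R] C}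
    (hx : Represents (restrictMap φ m) x) : ∃ y, Represents m y := by
  obtain ⟨y, rfl⟩ := hα.exists_rTensor_eq_of_exact
    (LinearMap.exact_map_mkQ_range (restrictMap φ)) (Submodule.mkQ_surjective _) fun f =>
      ⟨op (E.toSharp f) • m, (restrictMap_sharp_smul φ f m).trans (hx f)⟩
  refine ⟨y, fun f => hφ (?_ : restrictMap φ _ = restrictMap φ _)⟩
  rw [restrictMap_sharp_smul, hx, evalAt_rTensor]

end Represents

/-- The coaction `m ↦ ∑ mᵢ ⊗ cᵢ` of a rational module, where `∑ mᵢ ⊗ cᵢ` represents the action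
on `m`. -/
def rationalCoact (hα : E.AlphaCondition) (hM : E.IsRational M) :
    E.Restrict M →ₗ[Aᵐᵒᵖ] E.Cofree (E.Restrict M) where
  toFun m := E.toCofree _ (isRational_iff.1 hM m).choose
  map_add' m n := congrArg (E.toCofree _) <|
    (isRational_iff.1 hM (m + n)).choose_spec.unique hα <|
      (isRational_iff.1 hM m).choose_spec.add (isRational_iff.1 hM n).choose_spec
  map_smul' a m := congrArg (E.toCofree _) <|
    (isRational_iff.1 hM (a • m)).choose_spec.unique hα <|
      (isRational_iff.1 hM m).choose_spec.op_smul (unop a)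

theorem represents_rationalCoact (hα : E.AlphaCondition) (hM : E.IsRational M)
    (m : E.Restrict M) : Represents m ((E.toCofree _).symm (rationalCoact hα hM m)) :=
  (isRational_iff.1 hM m).choose_spec

/-- The entwined module structure on a rational module. -/
def rationalEntwined (hα : E.AlphaCondition) (hM : E.IsRational M) : E.EntwinedModule :=
  EntwinedModule.ofLinearMap (rationalCoact hα hM)
    (fun m => hα.ext fun g => by
      have hρ (f : C →ₗ[R] A) (n : E.Restrict M) := represents_rationalCoact hα hM n f
      rw [evalAt_rTensor, ← hρ]
      refine (E.toCofree _).symm.injective (hα.ext fun f => ?_)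
      rw [← hρ, restrict_smul_smul, hρ]
      exact evalAt_act_cofree g f _)
    (fun m => (represents_rationalCoact hα hM m (sharpConst 1)).symm.trans
      (one_smul E.Sharpᵐᵒᵖ m))

theorem toSharpModule_obj_rationalEntwined (hα : E.AlphaCondition) (hM : E.IsRational M) :
    E.toSharpModule.obj (rationalEntwined hα hM) = M :=
  congrArg (fun i => @ModuleCat.of E.Sharpᵐᵒᵖ _ M _ i) <| Module.ext' _ _ fun f m =>
    (represents_rationalCoact hα hM m (E.ofSharp (unop f))).symm

end Rational

section Subgenerated

theorem isRational_toSharpModule_obj (M : E.EntwinedModule) :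
    E.IsRational (E.toSharpModule.obj M) := by
  let ι : M.carrier →ₗ[Aᵐᵒᵖ] E.Restrict (E.toSharpModule.obj M) :=
    { toFun := fun m => m
      map_add' := fun _ _ => rfl
      map_smul' := fun a m => (EntwinedModule.act_const E M (unop a) m).symm }
  exact isRational_iff.2 fun m => ⟨(ι.restrictScalars R).rTensor C (M.coact m), fun f =>
    (evalAt_rTensor f ι (M.coact m)).symm⟩

theorem isSubgenerated_toSharpModule_obj (M : E.EntwinedModule) :
    IsSubgenerated E.coringModule (E.toSharpModule.obj M) := by
  let g (m : M.carrier) : A →ₗ[Aᵐᵒᵖ] M.carrier :=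
    { toFun := fun a => op a • m
      map_add' := fun a b => by rw [MulOpposite.op_add, add_smul]
      map_smul' := fun a b => mul_smul a (op b) m }
  let F (m : M.carrier) : E.coringModule →ₗ[E.Sharpᵐᵒᵖ] E.toSharpModule.obj (E.cofree M.carrier) :=
    (E.toSharpModule.map (cofreeMap (g m))).hom
  refine ⟨M.carrier, E.toSharpModule.obj (E.cofree M.carrier), Finsupp.lsum ℕ F,
    (E.toSharpModule.map M.coactHom).hom, fun x => ?_, M.coactLinearMap_injective⟩
  obtain ⟨x, rfl⟩ := (E.toCofree M.carrier).surjective x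
  induction x with
  | zero => exact ⟨0, map_zero _⟩
  | add y z hy hz =>
    obtain ⟨y', rfl⟩ := hy
    obtain ⟨z', rfl⟩ := hz
    exact ⟨y' + z', map_add _ _ _⟩
  | tmul m c =>
    refine ⟨Finsupp.single m (E.toCofree A (1 ⊗ₜ c)), (Finsupp.lsum_single ℕ F m _).trans ?_⟩
    change E.toCofree _ ((op (1 : A) • m) ⊗ₜ c) = _
    rw [op_one, one_smul]

theorem IsSubgenerated.isRational (hα : E.AlphaCondition) {N : ModuleCat.{u} E.Sharpᵐᵒᵖ}
    (hN : IsSubgenerated E.coringModule N) : E.IsRational N := by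
  obtain ⟨I, P, q, j, hq, hj⟩ := hN
  have hP (z : I →₀ E.coringModule) : ∃ x, Represents (M := P) (q z : P) x := by
    induction z using Finsupp.induction_linear with
    | zero => exact ⟨0, by rw [map_zero]; exact .zero⟩
    | add y z hy hz =>
      obtain ⟨y', hy⟩ := hy
      obtain ⟨z', hz⟩ := hz
      exact ⟨y' + z', by rw [map_add]; exact hy.add hz⟩
    | single i k =>
      obtain ⟨x, hx⟩ := isRational_iff.1 (isRational_toSharpModule_obj (E.cofree A)) k
      exact ⟨_, hx.map (q ∘ₗ Finsupp.lsingle i)⟩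
  refine isRational_iff.2 fun m => ?_
  obtain ⟨z, hz⟩ := hq (j m)
  obtain ⟨x, hx⟩ := hP z
  rw [hz] at hx
  exact hx.exists_of_injective hα j hj

theorem isRational_eq_isSubgenerated (hα : E.AlphaCondition) :
    E.IsRational = IsSubgenerated E.coringModule := by
  ext N
  refine ⟨fun hN => ?_, IsSubgenerated.isRational hα⟩
  rw [← toSharpModule_obj_rationalEntwined hα hN]
  exact isSubgenerated_toSharpModule_obj _

end Subgenerated

section Isomorphism

instance toSharpModule_faithful : E.toSharpModule.Faithful where
  map_injective hfg := EntwinedModule.Hom.ext <| LinearMap.ext fun m =>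
    LinearMap.congr_fun (congrArg ModuleCat.Hom.hom hfg) m

theorem toSharpModule_full (hα : E.AlphaCondition) : E.toSharpModule.Full where
  map_surjective {M N} φ := by
    have hsharp (f : C →ₗ[R] A) (m : M.carrier) : φ.hom (M.act f m) = N.act f (φ.hom m) :=
      φ.hom.map_smul (op (E.toSharp f)) m
    let φA : M.carrier →ₗ[Aᵐᵒᵖ] N.carrier :=
      { toFun := fun m => φ.hom m
        map_add' := map_add φ.hom
        map_smul' := fun a m => by
          have h := (hsharp (sharpConst (unop a)) m).trans (EntwinedModule.act_const E N _ _)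
          rwa [EntwinedModule.act_const E M] at h }
    refine ⟨⟨φA, fun m => hα.ext fun f => ?_⟩, rfl⟩
    rw [evalAt_rTensor]
    exact (hsharp f m).symm

theorem EntwinedModule.smul_eq_op_algebraMap_smul (M : E.EntwinedModule) (r : R)
    (m : M.carrier) : r • m = op (algebraMap R A r) • m := by
  rw [Algebra.algebraMap_eq_smul_one, MulOpposite.op_smul, smul_assoc, op_one, one_smul]

theorem toSharpModule_obj_injective (hα : E.AlphaCondition) :
    Function.Injective E.toSharpModule.obj := by
  rintro @⟨X, iX, mX, aX, tX, ρ, h₁, h₂, h₃⟩ @⟨Y, iY, mY, aY, tY, σ, k₁, k₂, k₃⟩ hMN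
  have hm := congr_arg_heq ModuleCat.isModule hMN
  obtain rfl : X = Y := congrArg ModuleCat.carrier hMN
  obtain rfl : iX = iY := eq_of_heq (congr_arg_heq ModuleCat.isAddCommGroup hMN)
  let M : E.EntwinedModule := @EntwinedModule.mk _ _ _ _ _ _ _ _ _ E X _ mX aX tX ρ h₁ h₂ h₃
  let N : E.EntwinedModule := @EntwinedModule.mk _ _ _ _ _ _ _ _ _ E X _ mY aY tY σ k₁ k₂ k₃
  have hact (f : C →ₗ[R] A) (m : X) : M.act f m = N.act f m :=
    congrArg (fun i : Module E.Sharpᵐᵒᵖ X => i.smul (op (E.toSharp f)) m) (eq_of_heq hm)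
  have hA : aX = aY := Module.ext' _ _ fun a m =>
    (EntwinedModule.act_const E M (unop a) m).symm.trans <|
      (hact (sharpConst (unop a)) m).trans (EntwinedModule.act_const E N (unop a) m)
  subst hA
  have hR : mX = mY := Module.ext' _ _ fun r m =>
    (M.smul_eq_op_algebraMap_smul r m).trans (N.smul_eq_op_algebraMap_smul r m).symm
  subst hR
  obtain rfl : ρ = σ := LinearMap.ext fun m => hα.ext fun f => hact f m
  rfl

theorem isIsomorphismOfCategories_lift (hα : E.AlphaCondition)
    {P : ObjectProperty (ModuleCat.{u} E.Sharpᵐᵒᵖ)} (hP : P ≤ E.IsRational)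
    (hE : ∀ M, P (E.toSharpModule.obj M)) :
    IsIsomorphismOfCategories (P.lift E.toSharpModule hE) where
  full := have := toSharpModule_full hα; inferInstance
  faithful := inferInstance
  bijective_obj :=
    ⟨fun _ _ h => toSharpModule_obj_injective hα
        (congrArg ObjectProperty.FullSubcategory.obj h),
      fun N => ⟨rationalEntwined hα (hP _ N.property), ObjectProperty.FullSubcategory.ext
        (toSharpModule_obj_rationalEntwined hα (hP _ N.property))⟩⟩

theorem isIsomorphismOfCategories_toSharpModule (hα : E.AlphaCondition)
    (h : ∀ N, E.IsRational N) : IsIsomorphismOfCategories E.toSharpModule where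
  full := toSharpModule_full hα
  faithful := inferInstance
  bijective_obj := ⟨toSharpModule_obj_injective hα, fun N =>
    ⟨rationalEntwined hα (h N), toSharpModule_obj_rationalEntwined hα (h N)⟩⟩

theorem isRational_of_finite_projective [Module.Finite R C] [Module.Projective R C]
    (N : ModuleCat.{u} E.Sharpᵐᵒᵖ) : E.IsRational N := by
  obtain ⟨n, π, i, -, -, hπi⟩ := Module.Finite.exists_comp_eq_id_of_projective R C
  let e (k : Fin n) : C := π (Pi.single k 1)
  let p (k : Fin n) : C →ₗ[R] A := (LinearMap.proj k ∘ₗ i).smulRight 1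
  have hf (f : C →ₗ[R] A) : f = ∑ k, E.sharpMul (p k) (sharpConst (f (e k))) := by
    ext c
    have hc : c = ∑ k, i c k • e k := by
      conv_lhs => rw [← LinearMap.id_apply (R := R) c, ← hπi, LinearMap.comp_apply,
        pi_eq_sum_univ' (i c), map_sum]
      simp only [map_smul, e]
    conv_lhs => rw [hc]
    simp [sharpMul_const, p]
  refine isRational_iff.2 fun m => ⟨∑ k, (op (E.toSharp (p k)) • m) ⊗ₜ e k, fun f => ?_⟩
  have hk (k : Fin n) : evalAt (E.Restrict N) f ((op (E.toSharp (p k)) • m) ⊗ₜ e k) =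
      op (E.toSharp (E.sharpMul (p k) (sharpConst (f (e k))))) • m :=
    (evalAt_tmul (E.Restrict N) f _ _).trans (restrict_smul_smul _ _ _)
  conv_lhs => rw [hf f]
  simp only [map_sum, hk, ← Finset.sum_smul, Finset.op_sum]

end Isomorphism

section Comonad

open Limits

/-- A right `A`-module with the `R`-module structure obtained by restriction of scalars along
`R → A`. -/
def ScalarRestrict (_R : Type*) {A : Type u} [Ring A] (N : ModuleCat.{u} Aᵐᵒᵖ) : Type u := N

instance (N : ModuleCat.{u} Aᵐᵒᵖ) : AddCommGroup (ScalarRestrict R N) :=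
  inferInstanceAs (AddCommGroup N)

instance (N : ModuleCat.{u} Aᵐᵒᵖ) : Module Aᵐᵒᵖ (ScalarRestrict R N) :=
  inferInstanceAs (Module Aᵐᵒᵖ N)

instance (N : ModuleCat.{u} Aᵐᵒᵖ) : Module R (ScalarRestrict R N) :=
  Module.restrictScalars R Aᵐᵒᵖ (ScalarRestrict R N)

instance (N : ModuleCat.{u} Aᵐᵒᵖ) : IsScalarTower R Aᵐᵒᵖ (ScalarRestrict R N) :=
  IsScalarTower.restrictScalars R Aᵐᵒᵖ (ScalarRestrict R N)

/-- A morphism of right `A`-modules as a linear map. -/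
def scalarRestrictMap {N P : ModuleCat.{u} Aᵐᵒᵖ} (f : N ⟶ P) :
    ScalarRestrict R N →ₗ[Aᵐᵒᵖ] ScalarRestrict R P := f.hom

variable (E) in
/-- The functor from entwined modules to right `A`-modules forgetting the coaction. -/
def forgetToModule : E.EntwinedModule ⥤ ModuleCat.{u} Aᵐᵒᵖ where
  obj M := ModuleCat.of Aᵐᵒᵖ M.carrier
  map f := ModuleCat.ofHom f.toLinearMap

variable (E) in
/-- The functor `N ↦ N ⊗ C` from right `A`-modules to entwined modules. -/
def cofreeFunctor : ModuleCat.{u} Aᵐᵒᵖ ⥤ E.EntwinedModule where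
  obj N := E.cofree (ScalarRestrict R N)
  map f := cofreeMap (scalarRestrictMap f)
  map_id _ := EntwinedModule.Hom.ext <| LinearMap.ext cofreeLinearMap_id_apply
  map_comp f g := EntwinedModule.Hom.ext <| LinearMap.ext <|
    cofreeLinearMap_comp_apply (scalarRestrictMap g) (scalarRestrictMap f)

/-- The identity from an entwined module to its underlying right `A`-module. It is not `R`-linear
by definition, since the two `R`-module structures agree only propositionally. -/
def forgetEquiv (M : E.EntwinedModule) :
    M.carrier ≃ₗ[Aᵐᵒᵖ] ScalarRestrict R (E.forgetToModule.obj M) := LinearEquiv.refl _ _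

variable (E) in
/-- The forgetful functor to right `A`-modules is left adjoint to `- ⊗ C`. -/
def forgetAdjunction : E.forgetToModule ⊣ E.cofreeFunctor :=
  Adjunction.mkOfUnitCounit
    { unit :=
        { app := fun M => M.coactHom ≫ cofreeMap (forgetEquiv M).toLinearMap
          naturality := fun M N f => EntwinedModule.Hom.ext <| LinearMap.ext fun m => by
            change E.cofreeLinearMap (forgetEquiv N).toLinearMap
                (N.coactLinearMap (f.toLinearMap m)) =
              E.cofreeLinearMap (scalarRestrictMap (E.forgetToModule.map f))
                (E.cofreeLinearMap (forgetEquiv M).toLinearMap (M.coactLinearMap m))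
            rw [← EntwinedModule.cofreeLinearMap_coactLinearMap,
              ← cofreeLinearMap_comp_apply, ← cofreeLinearMap_comp_apply]
            rfl }
      counit :=
        { app := fun N => ModuleCat.ofHom (E.counitLinearMap (ScalarRestrict R N))
          naturality := fun N P f => by
            ext x
            exact counitLinearMap_cofreeLinearMap (scalarRestrictMap f) x }
      left_triangle := by
        ext M m
        refine (counitLinearMap_cofreeLinearMap (forgetEquiv M).toLinearMap _).trans ?_
        exact congrArg (forgetEquiv M) (M.counitLinearMap_coactLinearMap m)
      right_triangle := by
        ext N : 2
        refine EntwinedModule.Hom.ext <| LinearMap.ext fun x => ?_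
        let K := E.cofree (ScalarRestrict R N)
        let ε : E.forgetToModule.obj K ⟶ N :=
          ModuleCat.ofHom (E.counitLinearMap (ScalarRestrict R N))
        refine (cofreeLinearMap_comp_apply (M := K.carrier) (scalarRestrictMap ε)
          (forgetEquiv K).toLinearMap (K.coactLinearMap x)).symm.trans ?_
        exact congrArg (E.toCofree _) (rTensor_counitLinearMap_cofreeCoact x) }

instance : E.forgetToModule.Faithful where
  map_injective h := EntwinedModule.Hom.ext (congrArg ModuleCat.Hom.hom h)

theorem cofreeLinearMap_forgetEquiv_injective (K : E.EntwinedModule) :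
    Function.Injective (E.cofreeLinearMap (forgetEquiv K).toLinearMap) :=
  Function.LeftInverse.injective (g := E.cofreeLinearMap (forgetEquiv K).symm.toLinearMap)
    fun x => by
      rw [← cofreeLinearMap_comp_apply, LinearEquiv.comp_coe, LinearEquiv.self_trans_symm]
      exact cofreeLinearMap_id_apply x

instance : (Comonad.comparison E.forgetAdjunction).Full where
  map_surjective {M N} φ := by
    let f : M.carrier →ₗ[Aᵐᵒᵖ] N.carrier := ModuleCat.Hom.hom φ.f
    refine ⟨⟨f, fun m => cofreeLinearMap_forgetEquiv_injective N ?_⟩, rfl⟩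
    refine (LinearMap.congr_fun (congrArg ModuleCat.Hom.hom φ.h) m).symm.trans ?_
    refine (cofreeLinearMap_comp_apply (scalarRestrictMap φ.f) (forgetEquiv M).toLinearMap
      (M.coactLinearMap m)).symm.trans ?_
    exact cofreeLinearMap_comp_apply (forgetEquiv N).toLinearMap f (M.coactLinearMap m)

/-- The structure map of a coalgebra over the comonad `- ⊗ C`. -/
def coalgebraLinearMap (X : E.forgetAdjunction.toComonad.Coalgebra) :
    ScalarRestrict R X.A →ₗ[Aᵐᵒᵖ] E.Cofree (ScalarRestrict R X.A) := X.a.hom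

theorem cofreeCoact_coalgebraLinearMap (X : E.forgetAdjunction.toComonad.Coalgebra)
    (m : ScalarRestrict R X.A) :
    E.cofreeCoact _ (coalgebraLinearMap X m) =
      ((coalgebraLinearMap X).restrictScalars R).rTensor C
        ((E.toCofree _).symm (coalgebraLinearMap X m)) := by
  let K := E.cofree (ScalarRestrict R X.A)
  have h : E.cofreeLinearMap (forgetEquiv K).toLinearMap
        (K.coactLinearMap (coalgebraLinearMap X m)) =
      E.cofreeLinearMap (N := ScalarRestrict R (E.forgetToModule.obj K))
        (scalarRestrictMap X.a) (coalgebraLinearMap X m) :=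
    LinearMap.congr_fun (congrArg ModuleCat.Hom.hom X.coassoc) m
  have h' := cofreeLinearMap_comp_apply (N := K.carrier) (forgetEquiv K).toLinearMap
    (coalgebraLinearMap X) (coalgebraLinearMap X m)
  exact cofreeLinearMap_forgetEquiv_injective K (h.trans h')

/-- The entwined module given by a coalgebra over the comonad `- ⊗ C`. -/
def ofCoalgebra (X : E.forgetAdjunction.toComonad.Coalgebra) : E.EntwinedModule :=
  EntwinedModule.ofLinearMap (coalgebraLinearMap X) (cofreeCoact_coalgebraLinearMap X)
    (LinearMap.congr_fun (congrArg ModuleCat.Hom.hom X.counit))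

instance : (Comonad.comparison E.forgetAdjunction).EssSurj where
  mem_essImage X := by
    let M := ofCoalgebra X
    let i : E.forgetToModule.obj M ≅ X.A := Iso.refl _
    refine ⟨M, ⟨Comonad.Coalgebra.isoMk i ?_⟩⟩
    ext m
    exact (cofreeLinearMap_comp_apply (scalarRestrictMap i.hom) (forgetEquiv M).toLinearMap
      (M.coactLinearMap m)).symm.trans (cofreeLinearMap_id_apply _)

instance : (Comonad.comparison E.forgetAdjunction).IsEquivalence where

instance : ComonadicLeftAdjoint E.forgetToModule where
  R := E.cofreeFunctor
  adj := E.forgetAdjunction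
  eqv := inferInstance

instance : (E.cofreeFunctor ⋙ E.forgetToModule).Additive where
  map_add {_ _ f g} := ModuleCat.hom_ext <|
    cofreeLinearMap_add (scalarRestrictMap f) (scalarRestrictMap g)

instance [Module.Flat R C] : PreservesFiniteLimits (E.cofreeFunctor ⋙ E.forgetToModule) := by
  refine (((E.cofreeFunctor ⋙ E.forgetToModule).exact_tfae.out 1 3 :).1 fun S hS => ?_).1
  rw [ShortComplex.ShortExact.moduleCat_exact_iff_function_exact] at hS ⊢
  have h : Function.Exact ((scalarRestrictMap (R := R) S.f).restrictScalars R)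
    ((scalarRestrictMap (R := R) S.g).restrictScalars R) := hS
  exact Module.Flat.rTensor_exact C h

end Comonad

section Grothendieck

open Limits

instance (M : E.EntwinedModule) : Mono M.coactHom :=
  E.forgetToModule.mono_of_mono_map <|
    (ModuleCat.mono_iff_injective _).2 M.coactLinearMap_injective

instance : HasColimitsOfSize.{u, u} E.EntwinedModule :=
  hasColimitsOfSize_of_comonadic E.forgetToModule

variable [PreservesFiniteLimits (E.cofreeFunctor ⋙ E.forgetToModule)]

instance : PreservesFiniteLimits
    (comonadicRightAdjoint E.forgetToModule ⋙ E.forgetToModule) :=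
  inferInstanceAs (PreservesFiniteLimits (E.cofreeFunctor ⋙ E.forgetToModule))

variable (E) in
/-- Entwined modules form an abelian category if `- ⊗ C` is left exact. This is a definition
because an abelian structure is data. -/
@[reducible] def abelianEntwinedModule : Abelian E.EntwinedModule :=
  abelianOfComonadic E.forgetToModule

attribute [local instance] abelianEntwinedModule

instance : HasSeparator E.EntwinedModule := by
  have := reflectsIsomorphisms_of_comonadic E.forgetToModule
  have := preservesFiniteLimits_of_comonadic E.forgetToModule
  have : WellPowered.{u} E.EntwinedModule := wellPowered_of_reflectsIsomorphisms E.forgetToModule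
  refine hasSeparator_of_lifts_through_subobjects E.forgetToModule
    (isSeparator_moduleCat_self Aᵐᵒᵖ) (E.cofree (ℕ →₀ Aᵐᵒᵖ)) fun M x => ?_
  obtain ⟨φ, y, hy⟩ := exists_rTensor_finsupp_eq Aᵐᵒᵖ (M.coact (x.hom (1 : Aᵐᵒᵖ)))
  refine ⟨_, M.coactHom, inferInstance, cofreeMap φ, ModuleCat.ofHom
    (LinearMap.toSpanSingleton Aᵐᵒᵖ _ (E.toCofree _ y)), ModuleCat.hom_ext <|
    LinearMap.ext_ring ?_⟩
  refine (congrArg (E.cofreeLinearMap φ) (one_smul Aᵐᵒᵖ (E.toCofree _ y))).trans ?_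
  exact congrArg (E.toCofree _) hy

theorem isGrothendieckAbelian_entwinedModule : IsGrothendieckAbelian.{u} E.EntwinedModule :=
  isGrothendieckAbelian_of_comonadic E.forgetToModule

end Grothendieck

end EntwiningStructure

end

theorem mainTheorem7_general {R A C : Type u} [CommRing R] [Ring A] [Algebra R A]
    [AddCommGroup C] [Module R C] [Coalgebra R C] (E : EntwiningStructure R A C) :
    (Limits.PreservesFiniteLimits (E.cofreeFunctor ⋙ E.forgetToModule) →
      ∃ _ : Abelian E.EntwinedModule,
        IsGrothendieckAbelian.{u} E.EntwinedModule ∧ EnoughInjectives E.EntwinedModule) ∧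
    (E.AlphaCondition →
      (∃ h : ∀ M, E.IsRational (E.toSharpModule.obj M),
        IsIsomorphismOfCategories (E.IsRational.lift E.toSharpModule h)) ∧
      (∃ h : ∀ M, IsSubgenerated E.coringModule (E.toSharpModule.obj M),
        IsIsomorphismOfCategories ((IsSubgenerated E.coringModule).lift E.toSharpModule h)) ∧
      E.IsRational = IsSubgenerated E.coringModule) ∧
    (Module.Finite R C → Module.Projective R C →
      IsIsomorphismOfCategories E.toSharpModule) := by
  refine ⟨fun _ => ?_, fun hα => ⟨?_, ?_, ?_⟩, fun _ _ => ?_⟩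
  · let := E.abelianEntwinedModule
    have := EntwiningStructure.isGrothendieckAbelian_entwinedModule (E := E)
    exact ⟨inferInstance, this, IsGrothendieckAbelian.enoughInjectives.{u}⟩
  · exact ⟨_, EntwiningStructure.isIsomorphismOfCategories_lift hα le_rfl
      EntwiningStructure.isRational_toSharpModule_obj⟩
  · exact ⟨_, EntwiningStructure.isIsomorphismOfCategories_lift hα
      (fun _ => EntwiningStructure.IsSubgenerated.isRational hα)
      EntwiningStructure.isSubgenerated_toSharpModule_obj⟩
  · exact EntwiningStructure.isRational_eq_isSubgenerated hα
  · exact EntwiningStructure.isIsomorphismOfCategories_toSharpModule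
      (EntwiningStructure.alphaCondition_of_isLocallyProjective .of_projective)
      EntwiningStructure.isRational_of_finite_projective

theorem mainTheorem7 {R A C : Type u} [CommRing R] [Ring A] [Algebra R A]
    [AddCommGroup C] [Module R C] [Coalgebra R C] (E : EntwiningStructure R A C) :
    (Module.Flat R C →
      ∃ _ : Abelian E.EntwinedModule,
        IsGrothendieckAbelian.{u} E.EntwinedModule ∧ EnoughInjectives E.EntwinedModule) ∧
    (IsLocallyProjective R C →
      E.AlphaCondition ∧
      (∃ h : ∀ M, E.IsRational (E.toSharpModule.obj M),
        IsIsomorphismOfCategories (E.IsRational.lift E.toSharpModule h)) ∧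
      (∃ h : ∀ M, IsSubgenerated E.coringModule (E.toSharpModule.obj M),
        IsIsomorphismOfCategories ((IsSubgenerated E.coringModule).lift E.toSharpModule h)) ∧
      E.IsRational = IsSubgenerated E.coringModule) ∧
    (Module.Finite R C → Module.Projective R C →
      IsIsomorphismOfCategories E.toSharpModule) := by
  obtain ⟨h₁, h₂, h₃⟩ := mainTheorem7_general E
  exact ⟨fun _ => h₁ inferInstance, fun hC =>
    have hα := EntwiningStructure.alphaCondition_of_isLocallyProjective hC
    ⟨hα, h₂ hα⟩, h₃⟩
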